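/- Let $q$ be a positive integer. Write $A^*$ for the conjugate transpose and $\|A\|$ for the operator norm of $A\in\mathbb C^{q\times q}$, put $\operatorname{Im}A=\frac1{2i}(A-A^*)$, and let $\Pi_+=\{z\in\mathbb C:\operatorname{Im}z>0\}$. A non-negative Hermitian $q\times q$ measure is a $\sigma$-additive map from the Borel sets of $\mathbb R$ to the non-negative Hermitian $q\times q$ matrices. Let $\mathcal R_q$ be the set of all holomorphic $F:\Pi_+\to\mathbb C^{q\times q}$ with $\operatorname{Im}F(z)$ non-negative Hermitian for all $z\in\Pi_+$. Every $F\in\mathcal R_q$ has a unique representation $$F(z)=\alpha_F+z\beta_F+\int_{\mathbb R}\frac{1+tz}{t-z}\,\nu_F(dt)\qquad(z\in\Pi_+)$$ with $\alpha_F$ Hermitian, $\beta_F$ non-negative Hermitian and $\nu_F$ a non-negative Hermitian $q\times q$ measure. Put $\gamma_F=\alpha_F-\int_{\mathbb R}t\,\nu_F(dt)$ and $\sigma_F(B)=\int_B(t^2+1)\,\nu_F(dt)$ (the spectral measure of $F$) whenever these integrals exist, which is the case for all $F\in\mathcal R_q^{[0]}$. Here $$\mathcal R_q^{[-1]}=\Bigl\{F\in\mathcal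 R_q:\int_1^\infty\tfrac1y\|\operatorname{Im}F(iy)\|\,dy<\infty\Bigr\},\qquad \mathcal R_q^{[0]}=\Bigl\{F\in\mathcal R_q:\sup_{y\ge1}y\|\operatorname{Im}F(iy)\|<\infty\Bigr\}.$$ For $\kappa\in\{0,1,2,\dots\}\cup\{\infty\}$ and $q\times q$ matrices $(s_j)_{j=-1}^{\kappa}$, let $\mathcal R_q^{[\kappa]}[\mathbb R;(s_j)_{j=-1}^{\kappa}]$ be the set of all $F\in\mathcal R_q^{[0]}$ such that $\gamma_F=-s_{-1}$ and such that $\int_{\mathbb R}t^j\,\sigma_F(dt)$ exists and equals $s_j$ for all integers $j$ with $0\le j\le\kappa$. For integers $k$ with $-1\le k\le\kappa$ put $$F^{\langle k\rangle}(z)=z^{k+1}F(z)+\sum_{j=0}^{k+1}z^{k+1-j}s_{j-1}\qquad(z\in\Pi_+).$$ Then the following hold. (1) Let $\kappa\in\{0,1,2,\dots\}\cup\{\infty\}$, let $(s_j)_{j=-1}^{\kappa}$ be complex $q\times q$ matrices and let $F\in\mathcal R_q^{[\kappa]}[\mathbb R;(s_j)_{j=-1}^{\kappa}]$. For every integer $k$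 with $-1\le k\le\kappa$ and every $\delta\in(0,\frac\pi2]$, $$\lim_{r\to\infty}\ \sup\bigl\{\|F^{\langle k\rangle}(z)\|:\ |z|\ge r,\ \delta\le\arg z\le\pi-\delta\bigr\}=0.$$ (2) Let $n\ge0$ be an integer, let $(s_j)_{j=-1}^{2n}$ be Hermitian $q\times q$ matrices and let $F\in\mathcal R_q$ satisfy $\lim_{y\to\infty}F^{\langle 2n\rangle}(iy)=0$. Then $F\in\mathcal R_q^{[2n]}[\mathbb R;(s_j)_{j=-1}^{2n}]$. (3) Let $n\ge0$ be an integer, let $(s_j)_{j=-1}^{2n+1}$ be Hermitian $q\times q$ matrices and let $F\in\mathcal R_q$ satisfy $\lim_{y\to\infty}F^{\langle 2n+1\rangle}(iy)=0$. Then $F^{\langle 2n+1\rangle}\in\mathcal R_q$. If, moreover, $F^{\langle 2n+1\rangle}\in\mathcal R_q^{[-1]}$, then $F\in\mathcal R_q^{[2n+1]}[\mathbb R;(s_j)_{j=-1}^{2n+1}]$. -/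

import Mathlib

open MeasureTheory Set Filter Topology
open scoped ENNReal ComplexOrder
-- `‖A‖` is the operator norm of a matrix with respect to the Euclidean norm.
open scoped Matrix.Norms.L2Operator

noncomputable section

namespace HamburgerNevanlinna

/-- Complex `q × q` matrices. -/
abbrev CMat (q : ℕ) : Type := Matrix (Fin q) (Fin q) ℂ

variable {q : ℕ}

/-- The imaginary part `(A - A*) / (2i)` of a complex square matrix. -/
def imPart (A : CMat q) : CMat q := (1 / (2 * Complex.I)) • (A - A.conjTranspose)

/-- The open upper half plane of `ℂ`. -/
def upperHalf : Set ℂ := {z | 0 < z.im}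

/-- The closed sector `{z : |z| ≥ r and δ ≤ arg z ≤ π - δ}`. -/
def sector (r δ : ℝ) : Set ℂ := {z | r ≤ ‖z‖ ∧ δ ≤ z.arg ∧ z.arg ≤ Real.pi - δ}

/-! ### Non-negative Hermitian measures and integration against them

A function `f` is integrable with respect to a non-negative Hermitian measure `σ` if it is
integrable with respect to the total variation of `σ` (`VectorMeasure.Integrable`), and the integral
is Mathlib's integral against a vector measure for the pairing "complex scalar times matrix". -/

/-- The set of non-negative Hermitian `q × q` measures on the Borel sets of `ℝ`: the σ-additive
maps from the Borel sets to the non-negative Hermitian matrices. -/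
def hermMeasures (q : ℕ) : Set (VectorMeasure ℝ (CMat q)) :=
  {σ | ∀ B : Set ℝ, MeasurableSet B → (σ B).PosSemidef}

/-- The pairing `(c, A) ↦ c • A` of complex scalars and matrices. -/
def scalarPairing (q : ℕ) : ℂ →L[ℝ] CMat q →L[ℝ] CMat q := ContinuousLinearMap.lsmul ℝ ℂ

/-- The integral `∫ f dσ` of a complex-valued function against a matrix-valued measure. -/
def matInt (σ : VectorMeasure ℝ (CMat q)) (f : ℝ → ℂ) : CMat q :=
  VectorMeasure.integral σ f (scalarPairing q)

/-- The `j`-th power moment `∫ t ^ j dσ`. -/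
def moment (σ : VectorMeasure ℝ (CMat q)) (j : ℕ) : CMat q := matInt σ (fun t => (t : ℂ) ^ j)

/-- The non-negative Hermitian measures whose power moments up to order `κ ∈ ℕ ∪ {∞}` exist. -/
def momentMeasures (q : ℕ) (κ : ℕ∞) : Set (VectorMeasure ℝ (CMat q)) :=
  {σ | σ ∈ hermMeasures q ∧
    ∀ j : ℕ, (j : ℕ∞) ≤ κ → σ.Integrable (fun t : ℝ => (t : ℂ) ^ j)}

/-- The solution set of the Hamburger moment problem with data `(s_j)_{j=0}^κ`: all non-negative
Hermitian measures whose moments up to order `κ` exist and are `s_0, s_1, …`. Sequences of matrices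
are indexed by `ℤ`; only the entries with index between `-1` and `κ` are ever used. -/
def momentSolutions (κ : ℕ∞) (s : ℤ → CMat q) : Set (VectorMeasure ℝ (CMat q)) :=
  {σ | σ ∈ momentMeasures q κ ∧ ∀ j : ℕ, (j : ℕ∞) ≤ κ → moment σ j = s j}

/-! ### Matrix-valued Herglotz-Nevanlinna functions

Functions on the open upper half plane are represented by functions on `ℂ`; no definition below
looks at the values outside the upper half plane. -/

/-- The class `R_q`: holomorphic in the open upper half plane with non-negative Hermitian
imaginary part. -/
def nevanlinna (q : ℕ) : Set (ℂ → CMat q) :=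
  {F | DifferentiableOn ℂ F upperHalf ∧ ∀ z ∈ upperHalf, (imPart (F z)).PosSemidef}

/-- `(α, β, ν)` is a Nevanlinna parametrization of `F`. -/
structure IsNevanlinnaParam (F : ℂ → CMat q)
    (p : CMat q × CMat q × VectorMeasure ℝ (CMat q)) : Prop where
  alpha_hermitian : p.1.IsHermitian
  beta_nonneg : p.2.1.PosSemidef
  nu_mem : p.2.2 ∈ hermMeasures q
  eq_integral : ∀ z ∈ upperHalf,
    F z = p.1 + z • p.2.1 + matInt p.2.2 (fun t : ℝ => (1 + (t : ℂ) * z) / ((t : ℂ) - z))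

open Classical in
/-- The Nevanlinna parametrization of `F`. Every `F ∈ R_q` has exactly one; the value `0`
is a default for functions without one. -/
def nevanlinnaParam (F : ℂ → CMat q) : CMat q × CMat q × VectorMeasure ℝ (CMat q) :=
  if h : ∃ p, IsNevanlinnaParam F p then h.choose else 0

/-- The Hermitian matrix `α_F`. -/
def alpha (F : ℂ → CMat q) : CMat q := (nevanlinnaParam F).1

/-- The Nevanlinna measure `ν_F`. -/
def nu (F : ℂ → CMat q) : VectorMeasure ℝ (CMat q) := (nevanlinnaParam F).2.2

/-- The matrix `γ_F = α_F - ∫ t dν_F`. -/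
def gamma (F : ℂ → CMat q) : CMat q := alpha F - moment (nu F) 1

/-- The spectral measure `σ_F(B) = ∫_B (t ^ 2 + 1) dν_F`. -/
def spectralMeasure (F : ℂ → CMat q) : VectorMeasure ℝ (CMat q) :=
  VectorMeasure.withDensity (nu F) (fun t : ℝ => (t : ℂ) ^ 2 + 1) (scalarPairing q)

/-- The class `R_q^{[-1]}`: those `F ∈ R_q` with `∫_1^∞ ‖Im F(iy)‖ / y dy < ∞`. -/
def nevanlinnaNegOne (q : ℕ) : Set (ℂ → CMat q) :=
  {F | F ∈ nevanlinna q ∧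
    IntegrableOn (fun y : ℝ => (1 / y) * ‖imPart (F (Complex.I * (y : ℂ)))‖) (Ici 1) volume}

/-- The class `R_q^{[0]}`: those `F ∈ R_q` with `sup_{y ≥ 1} y ‖Im F(iy)‖ < ∞`. -/
def nevanlinnaZero (q : ℕ) : Set (ℂ → CMat q) :=
  {F | F ∈ nevanlinna q ∧
    ∃ C : ℝ, ∀ y : ℝ, 1 ≤ y → y * ‖imPart (F (Complex.I * (y : ℂ)))‖ ≤ C}

/-- The class `R_q^{[κ]}` for `κ ∈ {0, 1, 2, …} ∪ {∞}`: those `F ∈ R_q^{[0]}` whose spectral measure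
has power moments up to order `κ`. -/
def nevanlinnaOrder (q : ℕ) (κ : ℕ∞) : Set (ℂ → CMat q) :=
  {F | F ∈ nevanlinnaZero q ∧ spectralMeasure F ∈ momentMeasures q κ}

/-- The class `R_q^{[κ]}[ℝ; (s_j)_{j=-1}^κ]`. -/
def nevanlinnaPrescribed (κ : ℕ∞) (s : ℤ → CMat q) : Set (ℂ → CMat q) :=
  {F | F ∈ nevanlinnaOrder q κ ∧ gamma F = -s (-1) ∧ spectralMeasure F ∈ momentSolutions κ s}

/-- The function `F^{<k>}(z) = z ^ (k + 1) F(z) + ∑_{j=0}^{k+1} z ^ (k + 1 - j) s_{j-1}`, for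
integers `k ≥ -1`. -/
def shifted (s : ℤ → CMat q) (k : ℤ) (F : ℂ → CMat q) : ℂ → CMat q :=
  fun z => z ^ (k + 1) • F z + ∑ j ∈ Finset.Icc (0 : ℤ) (k + 1), z ^ (k + 1 - j) • s (j - 1)

end HamburgerNevanlinna

end

open HamburgerNevanlinna

noncomputable section

namespace HamburgerNevanlinna

/-! ### Quadratic forms and polarization -/

variable {q : ℕ}

/-! Everything is reduced to scalars by testing against the forms `v* A v`. By polarization,
finitely many of these values determine a matrix linearly. A non-negative Hermitian measure thus
becomes a family of finite positive measures (`quadMeasure`), and integrability and integrals can be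
checked on that family (`integrable_iff_quadMeasure`, `quad_matInt`).

If `y Im F(iy)` stays bounded, the linear term of the Nevanlinna representation vanishes and `ν` has
a second moment. Hence `F` is `γ_F` plus the Cauchy transform of its spectral measure `σ`
(`isCauchyTransform_of_bounded`). The functions `F^{<k>}` satisfy `F^{<k>} = z F^{<k-1>} + s_k`, and
`t^{k+1}/(t-z) = z t^k/(t-z) + t^k`. So, as long as the moments agree with the `s_j`, `F^{<k>}(z) =
∫ t^{k+1}/(t-z) dσ`.

Part (1) is then dominated convergence, since `|t-z| ≥ sin δ · max(r,|t|)` on the sector. For part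
(2), decay of `F^{<2n>}(iy)` passes down to all lower indices. The real part of `y² ∫
t^{2m+1}/(t-iy) dσ` is `∫ y² t^{2m+2}/(t²+y²) dσ`; it is bounded by the recursion, and Fatou yields
the next even moment (`moments_of_tendsto`). For part (3), `Im (z t^{2n+1}/(t-z)) = Im z ·
t^{2n+2}/|t-z|²` gives positivity. Tonelli turns the condition on `∫ ‖Im F^{<2n+1>}(iy)‖ dy/y` into
integrability of `|t|^{2n+1}`.

The Nevanlinna representation is itself proved (`exists_isNevanlinnaParam`): the Cayley transform
moves `F` to the disc, the Herglotz formula holds on smaller circles, and weak compactness supplies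
the limit measures. These limits are taken along one ultrafilter for all `v`, so that they remain
quadratic in `v` and assemble into a matrix measure. -/

/-- The quadratic form `A ↦ v* A v` as a continuous linear functional of `A`. -/
def quad (v : Fin q → ℂ) : CMat q →L[ℂ] ℂ :=
  LinearMap.toContinuousLinearMap
    { toFun := fun A => star v ⬝ᵥ A.mulVec v
      map_add' := fun A B => by simp [Matrix.add_mulVec, dotProduct_add]
      map_smul' := fun c A => by simp [Matrix.smul_mulVec, dotProduct_smul] }

lemma quad_apply (v : Fin q → ℂ) (A : CMat q) : quad v A = star v ⬝ᵥ A.mulVec v := rfl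

/-- The vectors on which a quadratic form is evaluated in the polarization identity. -/
def polVec (a : Fin q × Fin q × Fin 4) : Fin q → ℂ :=
  Pi.single a.2.1 1 + Complex.I ^ (a.2.2 : ℕ) • Pi.single a.1 1

/-- The matrix coefficients of the polarization identity. -/
def polMat (a : Fin q × Fin q × Fin 4) : CMat q :=
  Matrix.single a.1 a.2.1 (Complex.I ^ (a.2.2 : ℕ) / 4)

/-- With `c` running over the fourth roots of unity, the form at `e_j + c e_i` contains `A i j` with
coefficient `conj c`. Averaging against `c` keeps that term and kills the others, because `∑ c = ∑
c² = 0`. -/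
lemma polarization (A : CMat q) : ∑ a, quad (polVec a) A • polMat a = A := by
  have hE : ∀ i j (c : ℂ), quad (Pi.single j 1 + c • Pi.single i 1) A =
      A j j + c * A j i + star c * A i j + star c * c * A i i := by
    intro i j c
    have h1 : ∀ i : Fin q, star (Pi.single i 1 : Fin q → ℂ) = Pi.single i 1 := by
      intro i; rw [← Pi.single_star]; simp
    simp only [quad_apply, star_add, star_smul, h1, Matrix.mulVec_add, Matrix.mulVec_smul,
      dotProduct_add, add_dotProduct, smul_dotProduct, dotProduct_smul, smul_eq_mul,
      Matrix.mulVec_single_one, single_one_dotProduct, Matrix.col_apply]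
    ring
  rw [Fintype.sum_prod_type]
  conv_rhs => rw [Matrix.matrix_eq_sum_single A]
  refine Finset.sum_congr rfl fun i _ => ?_
  rw [Fintype.sum_prod_type]
  refine Finset.sum_congr rfl fun j _ => ?_
  simp only [polVec, polMat, hE, Matrix.smul_single, ← Matrix.single_add, Fin.sum_univ_four]
  congr 1
  have hI2 := Complex.I_sq
  have hI3 : Complex.I ^ 3 = -Complex.I := by rw [pow_succ, hI2]; ring
  simp only [Fin.val_zero, Fin.val_one, Fin.val_two, pow_zero, pow_one, hI2, smul_eq_mul,
    show ((3 : Fin 4) : ℕ) = 3 from rfl, hI3]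
  simp only [star_one, star_neg, Complex.star_def, Complex.conj_I]
  linear_combination (A j i / 2 - A i j / 2) * hI2

lemma ext_quad {A B : CMat q} (h : ∀ v, quad v A = quad v B) : A = B := by
  rw [← polarization A, ← polarization B]
  simp only [h]

lemma norm_le_sum_quad (A : CMat q) : ‖A‖ ≤ ∑ a, ‖quad (polVec a) A‖ * ‖polMat (q := q) a‖ := by
  conv_lhs => rw [← polarization A]
  exact (norm_sum_le _ _).trans (Finset.sum_le_sum fun a _ => (norm_smul_le _ _))

lemma quad_conjTranspose (v : Fin q → ℂ) (A : CMat q) :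
    quad v A.conjTranspose = star (quad v A) := by
  rw [quad_apply, quad_apply, Matrix.star_dotProduct, Matrix.star_mulVec,
    Matrix.conjTranspose_conjTranspose, Matrix.dotProduct_mulVec]

lemma quad_imPart (v : Fin q → ℂ) (A : CMat q) : quad v (imPart A) = ((quad v A).im : ℂ) := by
  rw [imPart, map_smul, map_sub, quad_conjTranspose, Complex.star_def, Complex.sub_conj,
    smul_eq_mul]
  push_cast
  field_simp

lemma isHermitian_iff_quad {A : CMat q} : A.IsHermitian ↔ ∀ v, (quad v A).im = 0 := by
  constructor
  · intro h v
    have := quad_conjTranspose v A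
    rw [h.eq, Complex.star_def] at this
    exact Complex.conj_eq_iff_im.1 this.symm
  · intro h
    refine ext_quad fun v => ?_
    rw [quad_conjTranspose, Complex.star_def]
    exact Complex.conj_eq_iff_im.2 (h v)

/-- The order on `ℂ` forces the values to be real, and over `ℂ` real values of the form already make
the matrix Hermitian. -/
lemma posSemidef_iff_quad {A : CMat q} : A.PosSemidef ↔ ∀ v, 0 ≤ quad v A := by
  rw [Matrix.posSemidef_iff_dotProduct_mulVec]
  refine ⟨fun h v => h.2 v, fun h => ⟨isHermitian_iff_quad.2 fun v => ?_, h⟩⟩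
  exact ((Complex.nonneg_iff.1 (h v)).2).symm

lemma tendsto_quad {ι : Type*} {l : Filter ι} {f : ι → CMat q} {A : CMat q}
    (h : Tendsto f l (𝓝 A)) (v : Fin q → ℂ) : Tendsto (fun i => quad v (f i)) l (𝓝 (quad v A)) :=
  ((quad v).continuous.tendsto A).comp h

lemma quad_smul (v : Fin q → ℂ) (c : ℂ) (A : CMat q) : quad v (c • A) = c * quad v A := by
  rw [map_smul, smul_eq_mul]

/-! ### Scalar measures of a non-negative Hermitian measure -/

/-- The signed measure `B ↦ Re (v* σ(B) v)`. -/
def quadSigned (σ : VectorMeasure ℝ (CMat q)) (v : Fin q → ℂ) : SignedMeasure ℝ :=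
  σ.mapRange ((Complex.reCLM.toLinearMap.toAddMonoidHom).comp (quad v).toLinearMap.toAddMonoidHom)
    (Complex.reCLM.continuous.comp (quad v).continuous)

lemma quadSigned_apply (σ : VectorMeasure ℝ (CMat q)) (v : Fin q → ℂ) (B : Set ℝ) :
    quadSigned σ v B = (quad v (σ B)).re := rfl

lemma quadSigned_nonneg {σ : VectorMeasure ℝ (CMat q)} (hσ : σ ∈ hermMeasures q)
    (v : Fin q → ℂ) : 0 ≤[univ] quadSigned σ v := by
  rw [VectorMeasure.le_restrict_univ_iff_le]
  intro B hB
  simpa [quadSigned_apply] using (Complex.nonneg_iff.1 (posSemidef_iff_quad.1 (hσ B hB) v)).1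

/-- The finite measure `B ↦ v* σ(B) v` of a non-negative Hermitian measure `σ`. -/
def quadMeasure {σ : VectorMeasure ℝ (CMat q)} (hσ : σ ∈ hermMeasures q) (v : Fin q → ℂ) :
    Measure ℝ :=
  (quadSigned σ v).toMeasureOfZeroLE univ MeasurableSet.univ (quadSigned_nonneg hσ v)

instance {σ : VectorMeasure ℝ (CMat q)} (hσ : σ ∈ hermMeasures q) (v : Fin q → ℂ) :
    IsFiniteMeasure (quadMeasure hσ v) := by
  unfold quadMeasure; infer_instance

lemma quadMeasure_real {σ : VectorMeasure ℝ (CMat q)} (hσ : σ ∈ hermMeasures q) (v : Fin q → ℂ)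
    {B : Set ℝ} (hB : MeasurableSet B) :
    ((quadMeasure hσ v).real B : ℂ) = quad v (σ B) := by
  rw [quadMeasure, SignedMeasure.toMeasureOfZeroLE_real_apply _ _ _ hB, univ_inter,
    quadSigned_apply]
  have := Complex.nonneg_iff.1 (posSemidef_iff_quad.1 (hσ B hB) v)
  exact Complex.ext (by simp) (by simpa using this.2)

lemma enorm_quad_eq {σ : VectorMeasure ℝ (CMat q)} (hσ : σ ∈ hermMeasures q) (v : Fin q → ℂ)
    {B : Set ℝ} (hB : MeasurableSet B) : quadMeasure hσ v B = ‖quad v (σ B)‖ₑ := by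
  rw [← quadMeasure_real hσ v hB, ← ofReal_norm, Complex.norm_real,
    Real.norm_of_nonneg measureReal_nonneg, ofReal_measureReal]

lemma variation_le_sum_quadMeasure {σ : VectorMeasure ℝ (CMat q)} (hσ : σ ∈ hermMeasures q) :
    σ.variation ≤ ∑ a, ‖polMat (q := q) a‖₊ • quadMeasure hσ (polVec a) := by
  refine VectorMeasure.variation_le_of_forall_enorm_le fun B hB => ?_
  conv_lhs => rw [← polarization (σ B)]
  refine (enorm_sum_le _ _).trans ?_
  rw [Measure.coe_finsetSum, Finset.sum_apply]
  refine Finset.sum_le_sum fun a _ => ?_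
  rw [enorm_smul, Measure.smul_apply, enorm_quad_eq hσ _ hB, mul_comm]
  rfl

lemma quadMeasure_le_variation {σ : VectorMeasure ℝ (CMat q)} (hσ : σ ∈ hermMeasures q)
    (v : Fin q → ℂ) : quadMeasure hσ v ≤ ‖quad v‖₊ • σ.variation := by
  refine Measure.le_intro fun B hB _ => ?_
  rw [enorm_quad_eq hσ v hB, Measure.smul_apply]
  refine ((quad v).le_opENorm _).trans ?_
  exact mul_le_mul' le_rfl (VectorMeasure.enorm_measure_le_variation _ _)

lemma integrable_quadMeasure {E : Type*} [NormedAddCommGroup E]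
    {σ : VectorMeasure ℝ (CMat q)} (hσ : σ ∈ hermMeasures q) (v : Fin q → ℂ) {f : ℝ → E}
    (hf : σ.Integrable f) : Integrable f (quadMeasure hσ v) :=
  (Integrable.smul_measure_nnreal hf (c := ‖quad v‖₊)).mono_measure (quadMeasure_le_variation hσ v)

/-- The variation dominates each scalar measure up to a constant and, by polarization, is dominated
by a finite combination of them. -/
lemma integrable_iff_quadMeasure {E : Type*} [NormedAddCommGroup E]
    {σ : VectorMeasure ℝ (CMat q)} (hσ : σ ∈ hermMeasures q) {f : ℝ → E} :
    σ.Integrable f ↔ ∀ v, Integrable f (quadMeasure hσ v) := by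
  refine ⟨fun hf v => integrable_quadMeasure hσ v hf, fun h => ?_⟩
  refine Integrable.mono_measure ?_ (variation_le_sum_quadMeasure hσ)
  exact integrable_finsetSum_measure.2 fun a _ => (h _).smul_measure_nnreal

lemma isFiniteMeasure_variation {σ : VectorMeasure ℝ (CMat q)} (hσ : σ ∈ hermMeasures q) :
    IsFiniteMeasure σ.variation := by
  have := (integrable_iff_quadMeasure hσ (f := fun _ => (1 : ℝ))).2 fun v => integrable_const _
  exact (integrable_const_iff_isFiniteMeasure one_ne_zero).1 this

lemma scalarPairing_apply (c : ℂ) (A : CMat q) : scalarPairing q c A = c • A := rfl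

lemma quadMeasure_absolutelyContinuous {σ : VectorMeasure ℝ (CMat q)} (hσ : σ ∈ hermMeasures q)
    (v : Fin q → ℂ) : quadMeasure hσ v ≪ σ.variation :=
  Measure.absolutelyContinuous_of_le_smul (quadMeasure_le_variation hσ v)

lemma continuous_integral_quadMeasure {σ : VectorMeasure ℝ (CMat q)} (hσ : σ ∈ hermMeasures q)
    (v : Fin q → ℂ) :
    Continuous fun f : ℝ →₁[σ.variation] ℂ => ∫ t, f t ∂quadMeasure hσ v := by
  refine LipschitzWith.continuous (K := ‖quad v‖₊) <| LipschitzWith.of_dist_le_mul fun f g => ?_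
  have hf := L1.integrable_coeFn f
  have hg := L1.integrable_coeFn g
  rw [dist_eq_norm, ← MeasureTheory.integral_sub (integrable_quadMeasure hσ v hf)
    (integrable_quadMeasure hσ v hg), dist_eq_norm, L1.norm_eq_integral_norm,
    ← smul_eq_mul, ← NNReal.smul_def, ← integral_smul_nnreal_measure]
  refine (norm_integral_le_integral_norm _).trans ?_
  have h1 : (fun t => ‖f t - g t‖) =ᵐ[‖quad v‖₊ • σ.variation] fun t => ‖(f - g) t‖ :=
    (Measure.smul_absolutelyContinuous (c := ‖quad v‖₊)).ae_eq
      ((Lp.coeFn_sub f g).symm.mono fun t ht => by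
        simp only [Pi.sub_apply] at ht; simp only [ht])
  rw [← MeasureTheory.integral_congr_ae h1]
  exact integral_mono_measure (quadMeasure_le_variation hσ v) (.of_forall fun t => norm_nonneg _)
    (Integrable.smul_measure_nnreal (hf.sub hg).norm)

/-- Both sides are additive and continuous on `L¹` of the variation and agree on indicators, so
density of simple functions gives equality. -/
lemma quad_matInt {σ : VectorMeasure ℝ (CMat q)} (hσ : σ ∈ hermMeasures q) (v : Fin q → ℂ)
    {f : ℝ → ℂ} (hf : σ.Integrable f) :
    quad v (matInt σ f) = ∫ t, f t ∂quadMeasure hσ v := by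
  have := isFiniteMeasure_variation hσ
  refine Integrable.induction (μ := σ.variation)
    (fun f => quad v (matInt σ f) = ∫ t, f t ∂quadMeasure hσ v) ?_ ?_ ?_ ?_ hf
  · intro c s hs _
    rw [matInt, VectorMeasure.integral_indicator hs, MeasureTheory.integral_indicator hs,
      VectorMeasure.setIntegral_const, setIntegral_const, scalarPairing_apply, quad_smul,
      ← quadMeasure_real hσ v hs, mul_comm]
    simp
  · intro f g _ hf hg h1 h2
    simp only [matInt, Pi.add_apply] at h1 h2 ⊢
    rw [VectorMeasure.integral_add hf hg, map_add, h1, h2,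
      MeasureTheory.integral_add (integrable_quadMeasure hσ v hf) (integrable_quadMeasure hσ v hg)]
  · have h1 : Continuous fun f : ℝ →₁[σ.variation] ℂ => quad v (matInt σ f) :=
      (quad v).continuous.comp VectorMeasure.continuous_integral
    exact isClosed_eq h1 (continuous_integral_quadMeasure hσ v)
  · intro f g hfg hf h
    rw [← MeasureTheory.integral_congr_ae ((quadMeasure_absolutelyContinuous hσ v).ae_eq hfg), ← h,
      matInt, matInt, VectorMeasure.integral_congr_ae hfg]

lemma quad_withDensity {σ : VectorMeasure ℝ (CMat q)} (hσ : σ ∈ hermMeasures q) (v : Fin q → ℂ)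
    {f : ℝ → ℂ} (hf : σ.Integrable f) {B : Set ℝ} (hB : MeasurableSet B) :
    quad v (VectorMeasure.withDensity σ f (scalarPairing q) B) =
      ∫ t in B, f t ∂quadMeasure hσ v := by
  rw [VectorMeasure.withDensity_apply hf, ← VectorMeasure.integral_indicator hB,
    ← MeasureTheory.integral_indicator hB]
  exact quad_matInt hσ v (hf.indicator hB)

lemma withDensity_mem_hermMeasures {σ : VectorMeasure ℝ (CMat q)} (hσ : σ ∈ hermMeasures q)
    {f : ℝ → ℝ} (hf : σ.Integrable fun t => (f t : ℂ)) (h0 : ∀ t, 0 ≤ f t) :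
    VectorMeasure.withDensity σ (fun t => (f t : ℂ)) (scalarPairing q) ∈ hermMeasures q := by
  intro B hB
  rw [posSemidef_iff_quad]
  intro v
  rw [quad_withDensity hσ v hf hB, integral_complex_ofReal]
  exact_mod_cast setIntegral_nonneg hB fun t _ => h0 t

lemma quadMeasure_withDensity {σ : VectorMeasure ℝ (CMat q)} (hσ : σ ∈ hermMeasures q)
    {f : ℝ → ℝ} (hf : σ.Integrable fun t => (f t : ℂ)) (h0 : ∀ t, 0 ≤ f t) (v : Fin q → ℂ) :
    quadMeasure (withDensity_mem_hermMeasures hσ hf h0) v =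
      (quadMeasure hσ v).withDensity fun t => ENNReal.ofReal (f t) := by
  ext B hB
  have hi : Integrable f (quadMeasure hσ v) := (integrable_quadMeasure hσ v hf).re
  rw [MeasureTheory.withDensity_apply _ hB, ← ofReal_integral_eq_lintegral_ofReal hi.integrableOn
    (.of_forall h0), ← ofReal_measureReal]
  congr 1
  have := quadMeasure_real (withDensity_mem_hermMeasures hσ hf h0) v hB
  rw [quad_withDensity hσ v hf hB, integral_complex_ofReal] at this
  exact_mod_cast this

/-! ### Cauchy kernels -/

lemma im_pos_le_norm_ofReal_sub (t : ℝ) (z : ℂ) : z.im ≤ ‖(t : ℂ) - z‖ := by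
  have := Complex.abs_im_le_norm ((t : ℂ) - z)
  simp only [Complex.sub_im, Complex.ofReal_im, zero_sub, abs_neg] at this
  exact (le_abs_self _).trans this

lemma ofReal_sub_ne_zero {z : ℂ} (hz : 0 < z.im) (t : ℝ) : (t : ℂ) - z ≠ 0 :=
  norm_pos_iff.1 (hz.trans_le (im_pos_le_norm_ofReal_sub t z))

lemma integrable_cauchyKernel (σ : Measure ℝ) [IsFiniteMeasure σ] {z : ℂ} (hz : 0 < z.im) :
    Integrable (fun t : ℝ => 1 / ((t : ℂ) - z)) σ := by
  refine Integrable.mono' (integrable_const (z.im)⁻¹)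
    (Measurable.aestronglyMeasurable (by fun_prop)) (.of_forall fun t => ?_)
  rw [norm_div, norm_one, one_div]
  exact inv_anti₀ hz (im_pos_le_norm_ofReal_sub t z)

lemma herglotzKernel_eq {z : ℂ} (hz : 0 < z.im) (t : ℝ) :
    (1 + (t : ℂ) * z) / ((t : ℂ) - z) = z + (1 + z ^ 2) * (1 / ((t : ℂ) - z)) := by
  have := ofReal_sub_ne_zero hz t
  field_simp
  ring

lemma integrable_herglotzKernel (ν : Measure ℝ) [IsFiniteMeasure ν] {z : ℂ} (hz : 0 < z.im) :
    Integrable (fun t : ℝ => (1 + (t : ℂ) * z) / ((t : ℂ) - z)) ν := by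
  simp only [herglotzKernel_eq hz]
  exact (integrable_const _).add ((integrable_cauchyKernel ν hz).const_mul _)

/-- A sequence with `a 0 = ∫ 1 / (t - z) dσ` and `a (K + 1) = z a K + s K`, where `s K` is the
`K`-th moment of `σ`, consists of the integrals of `t ^ K / (t - z)`. -/
lemma eq_integral_pow_div {σ : Measure ℝ} [IsFiniteMeasure σ] {z : ℂ} (hz : 0 < z.im)
    {a s : ℕ → ℂ} (h0 : a 0 = ∫ t : ℝ, 1 / ((t : ℂ) - z) ∂σ)
    (hs : ∀ K, a (K + 1) = z * a K + s K) (K : ℕ)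
    (hm : ∀ j < K, Integrable (fun t : ℝ => (t : ℂ) ^ j) σ ∧ ∫ t : ℝ, (t : ℂ) ^ j ∂σ = s j) :
    Integrable (fun t : ℝ => (t : ℂ) ^ K / ((t : ℂ) - z)) σ ∧
      a K = ∫ t : ℝ, (t : ℂ) ^ K / ((t : ℂ) - z) ∂σ := by
  induction K with
  | zero => simpa using And.intro (by simpa using integrable_cauchyKernel σ hz) h0
  | succ K ih =>
    obtain ⟨hi, he⟩ := ih fun j hj => hm j (hj.trans K.lt_succ_self)
    obtain ⟨hi', he'⟩ := hm K K.lt_succ_self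
    have h : (fun t : ℝ => (t : ℂ) ^ (K + 1) / ((t : ℂ) - z)) =
        fun t : ℝ => z * ((t : ℂ) ^ K / ((t : ℂ) - z)) + (t : ℂ) ^ K := by
      ext t
      have := ofReal_sub_ne_zero hz t
      field_simp
      ring
    rw [h]
    refine ⟨(hi.const_mul z).add hi', ?_⟩
    rw [integral_add (hi.const_mul z) hi', integral_const_mul, hs, he, he']

/-! ### Limits along the imaginary axis -/

/-- Dominated convergence: `iy/(t-iy)` tends to `-1` and is bounded by `1`, since `|t-iy| ≥ y`. -/
lemma tendsto_integral_mul_div {σ : Measure ℝ} {h : ℝ → ℂ} (hh : Integrable h σ) :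
    Tendsto (fun y : ℝ => (Complex.I * y) * ∫ t : ℝ, h t / ((t : ℂ) - Complex.I * y) ∂σ) atTop
      (𝓝 (-∫ t, h t ∂σ)) := by
  rw [← integral_neg]
  simp only [← integral_const_mul]
  refine tendsto_integral_filter_of_dominated_convergence (fun t => ‖h t‖) ?_ ?_ hh.norm ?_
  · refine .of_forall fun y => ?_
    have := hh.aestronglyMeasurable
    have h2 : AEStronglyMeasurable (fun t : ℝ => ((t : ℂ) - Complex.I * y)⁻¹) σ :=
      Measurable.aestronglyMeasurable (by fun_prop)
    simp only [div_eq_mul_inv]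
    exact (this.mul h2).const_mul _
  · filter_upwards [eventually_gt_atTop 0] with y hy
    refine .of_forall fun t => ?_
    have hz : 0 < (Complex.I * (y : ℂ)).im := by simpa
    have h1 := im_pos_le_norm_ofReal_sub t (Complex.I * y)
    have h2 := norm_pos_iff.2 (ofReal_sub_ne_zero hz t)
    simp only [norm_mul, norm_div, Complex.norm_I, one_mul, Complex.norm_real,
      Real.norm_of_nonneg hy.le]
    rw [← mul_div_assoc, div_le_iff₀ h2, mul_comm]
    simp only [Complex.mul_im, Complex.I_re, Complex.I_im, Complex.ofReal_re, Complex.ofReal_im,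
      zero_mul, one_mul, zero_add] at h1
    gcongr
  · refine .of_forall fun t => ?_
    have h1 : Tendsto (fun y : ℝ => (t : ℂ) / (Complex.I * y) - 1) atTop (𝓝 (0 - 1)) := by
      refine Tendsto.sub_const ?_ 1
      rw [tendsto_zero_iff_norm_tendsto_zero]
      simp only [norm_div, norm_mul, Complex.norm_I, one_mul, Complex.norm_real]
      exact Tendsto.div_atTop tendsto_const_nhds tendsto_norm_atTop_atTop
    have h2 := (h1.inv₀ (by norm_num)).const_mul (h t)
    have h3 : h t * (0 - 1 : ℂ)⁻¹ = -h t := by norm_num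
    rw [h3] at h2
    refine h2.congr' ?_
    filter_upwards [eventually_gt_atTop 0] with y hy
    have hz : 0 < (Complex.I * (y : ℂ)).im := by simpa
    have h4 := ofReal_sub_ne_zero hz t
    have h5 : (y : ℂ) ≠ 0 := by exact_mod_cast hy.ne'
    have h6 : (t : ℂ) / (Complex.I * y) - 1 = (t - Complex.I * y) / (Complex.I * y) := by
      rw [sub_div, div_self (mul_ne_zero Complex.I_ne_zero h5)]
    rw [h6, inv_div]
    ring

/-- Fatou's lemma along integer `y`, as the weights tend to `1`. The hypothesis `hi` rules out that
the bound holds only through the default value `0` of a non-convergent integral. -/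
lemma integrable_of_bounded_integral {μ : Measure ℝ} {h : ℝ → ℝ} (hm : Measurable h)
    (h0 : ∀ t, 0 ≤ h t) {C : ℝ}
    (hi : ∀ᶠ y : ℝ in atTop, Integrable (fun t => y ^ 2 / (t ^ 2 + y ^ 2) * h t) μ)
    (hC : ∀ᶠ y : ℝ in atTop, ∫ t, y ^ 2 / (t ^ 2 + y ^ 2) * h t ∂μ ≤ C) : Integrable h μ := by
  refine ⟨hm.aestronglyMeasurable, ?_⟩
  rw [hasFiniteIntegral_iff_ofReal (.of_forall h0)]
  have hlim : ∀ t, Tendsto (fun n : ℕ => ENNReal.ofReal ((n : ℝ) ^ 2 / (t ^ 2 + (n : ℝ) ^ 2) * h t))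
      atTop (𝓝 (ENNReal.ofReal (h t))) := by
    intro t
    refine (ENNReal.continuous_ofReal.tendsto _).comp ?_
    have h1 : Tendsto (fun y : ℝ => (t ^ 2 / y ^ 2 + 1)⁻¹) atTop (𝓝 (0 + 1)⁻¹) :=
      ((Tendsto.div_atTop tendsto_const_nhds (tendsto_pow_atTop two_ne_zero)).add_const 1).inv₀
        (by norm_num)
    have h2 := (h1.comp tendsto_natCast_atTop_atTop).mul_const (h t)
    rw [zero_add, inv_one, one_mul] at h2
    refine h2.congr' ?_
    filter_upwards [eventually_gt_atTop 0] with n hn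
    have : (n : ℝ) ≠ 0 := by exact_mod_cast hn.ne'
    simp only [Function.comp]
    congr 1
    field_simp
  calc ∫⁻ t, ENNReal.ofReal (h t) ∂μ
      = ∫⁻ t, liminf (fun n : ℕ => ENNReal.ofReal ((n : ℝ) ^ 2 / (t ^ 2 + (n : ℝ) ^ 2) * h t))
          atTop ∂μ := by simp only [fun t => (hlim t).liminf_eq]
    _ ≤ liminf (fun n : ℕ =>
          ∫⁻ t, ENNReal.ofReal ((n : ℝ) ^ 2 / (t ^ 2 + (n : ℝ) ^ 2) * h t) ∂μ) atTop :=
        lintegral_liminf_le fun n => by fun_prop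
    _ ≤ liminf (fun _ : ℕ => ENNReal.ofReal C) atTop := by
        refine liminf_le_liminf ?_
        filter_upwards [tendsto_natCast_atTop_atTop.eventually hi,
          tendsto_natCast_atTop_atTop.eventually hC] with n h1 h2
        rw [← ofReal_integral_eq_lintegral_ofReal h1]
        · exact ENNReal.ofReal_le_ofReal h2
        · exact .of_forall fun t => mul_nonneg (by positivity) (h0 t)
    _ < ∞ := by rw [liminf_const]; exact ENNReal.ofReal_lt_top

/-- If `a (K + 1)` tends to zero along the imaginary axis and the `K`-th moment exists, then it is
`s K`. -/
lemma moment_eq_of_tendsto {σ : Measure ℝ} {K : ℕ} {s : ℂ} {a b : ℝ → ℂ}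
    (ha : ∀ y > 0, a y = ∫ t : ℝ, (t : ℂ) ^ K / ((t : ℂ) - Complex.I * y) ∂σ)
    (hb : ∀ y > 0, b y = Complex.I * y * a y + s) (hlim : Tendsto b atTop (𝓝 0))
    (hi : Integrable (fun t : ℝ => (t : ℂ) ^ K) σ) : ∫ t : ℝ, (t : ℂ) ^ K ∂σ = s := by
  have h1 := (tendsto_integral_mul_div hi).add_const s
  have h2 : Tendsto b atTop (𝓝 (-(∫ t : ℝ, (t : ℂ) ^ K ∂σ) + s)) := by
    refine h1.congr' ?_
    filter_upwards [eventually_gt_atTop 0] with y hy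
    rw [hb y hy, ha y hy]
  have := tendsto_nhds_unique hlim h2
  linear_combination this

lemma tendsto_zero_of_mul_add {a b : ℝ → ℂ} {s : ℂ}
    (hab : ∀ y > 0, b y = Complex.I * y * a y + s) (hb : Tendsto b atTop (𝓝 0)) :
    Tendsto a atTop (𝓝 0) := by
  have h1 : Tendsto (fun y : ℝ => Complex.I * (y : ℂ)) atTop (Bornology.cobounded ℂ) := by
    rw [← tendsto_norm_atTop_iff_cobounded]
    simpa using tendsto_abs_atTop_atTop
  have h2 := (tendsto_inv₀_cobounded.comp h1).mul (hb.sub_const s)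
  rw [zero_mul] at h2
  refine h2.congr' ?_
  filter_upwards [eventually_gt_atTop 0] with y hy
  have h5 : (y : ℂ) ≠ 0 := by exact_mod_cast hy.ne'
  have := Complex.I_ne_zero
  simp only [Function.comp, hab y hy]
  field_simp
  ring

lemma tendsto_zero_of_le {a : ℕ → ℝ → ℂ} {s : ℕ → ℂ}
    (hrec : ∀ K, ∀ y : ℝ, 0 < y → a (K + 1) y = Complex.I * y * a K y + s K) {N : ℕ}
    (hN : Tendsto (a N) atTop (𝓝 0)) : ∀ K ≤ N, Tendsto (a K) atTop (𝓝 0) := by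
  intro K hK
  induction N, hK using Nat.le_induction with
  | base => exact hN
  | succ N _ ih => exact ih (tendsto_zero_of_mul_add (hrec N) hN)

lemma div_ofReal_sub_eq {y : ℝ} (hy : 0 < y) (t : ℝ) (w : ℂ) :
    w / ((t : ℂ) - Complex.I * y) = w * (t + Complex.I * y) / ((t ^ 2 + y ^ 2 : ℝ) : ℂ) := by
  have hz : 0 < (Complex.I * (y : ℂ)).im := by simpa
  have h1 := ofReal_sub_ne_zero hz t
  have h2 : ((t ^ 2 + y ^ 2 : ℝ) : ℂ) ≠ 0 := by
    exact_mod_cast (by positivity : t ^ 2 + y ^ 2 ≠ 0)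
  rw [div_eq_div_iff h1 h2]
  push_cast
  linear_combination w * y ^ 2 * Complex.I_sq

lemma re_pow_div_ofReal_sub {y : ℝ} (hy : 0 < y) (t : ℝ) (K : ℕ) :
    ((t : ℂ) ^ K / ((t : ℂ) - Complex.I * y)).re = t ^ (K + 1) / (t ^ 2 + y ^ 2) := by
  rw [div_ofReal_sub_eq hy, Complex.div_ofReal_re, ← Complex.ofReal_pow]
  simp [pow_succ, -Complex.ofReal_pow]

lemma integrable_ofReal_pow {σ : Measure ℝ} {j : ℕ} :
    Integrable (fun t : ℝ => (t : ℂ) ^ j) σ ↔ Integrable (fun t : ℝ => t ^ j) σ := by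
  simp only [← Complex.ofReal_pow]
  exact ⟨fun h => h.re, fun h => h.ofReal⟩

lemma integrable_pow_of_le {σ : Measure ℝ} [IsFiniteMeasure σ] {j k : ℕ} (hjk : j ≤ k)
    (h : Integrable (fun t : ℝ => t ^ k) σ) : Integrable (fun t : ℝ => t ^ j) σ := by
  refine Integrable.mono' (h.norm.add (integrable_const 1))
    (Measurable.aestronglyMeasurable (by fun_prop)) (.of_forall fun t => ?_)
  simp only [norm_pow, Real.norm_eq_abs, Pi.add_apply]
  rcases le_total |t| 1 with ht | ht
  · exact (pow_le_one₀ (abs_nonneg t) ht).trans (le_add_of_nonneg_left (by positivity))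
  · exact (pow_le_pow_right₀ ht hjk).trans (le_add_of_nonneg_right zero_le_one)

/-- The Hamburger–Nevanlinna argument: the asymptotic expansion of a Cauchy transform along the
imaginary axis determines the moments. -/
lemma moments_of_tendsto {σ : Measure ℝ} [IsFiniteMeasure σ] {a : ℕ → ℝ → ℂ} {s : ℕ → ℂ} {n : ℕ}
    (h0 : ∀ y : ℝ, 0 < y → a 0 y = ∫ t : ℝ, 1 / ((t : ℂ) - Complex.I * y) ∂σ)
    (hrec : ∀ K, ∀ y : ℝ, 0 < y → a (K + 1) y = Complex.I * y * a K y + s K)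
    (him : ∀ j < 2 * n + 1, (s j).im = 0) (hlim : Tendsto (a (2 * n + 1)) atTop (𝓝 0)) :
    ∀ j < 2 * n + 1, Integrable (fun t : ℝ => (t : ℂ) ^ j) σ ∧ ∫ t : ℝ, (t : ℂ) ^ j ∂σ = s j := by
  have hz : ∀ y : ℝ, 0 < y → 0 < (Complex.I * (y : ℂ)).im := fun y hy => by simpa
  have hlim' := tendsto_zero_of_le hrec hlim
  have hrep : ∀ K, (∀ j < K, Integrable (fun t : ℝ => (t : ℂ) ^ j) σ ∧
      ∫ t : ℝ, (t : ℂ) ^ j ∂σ = s j) → ∀ y : ℝ, 0 < y →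
      Integrable (fun t : ℝ => (t : ℂ) ^ K / ((t : ℂ) - Complex.I * y)) σ ∧
      a K y = ∫ t : ℝ, (t : ℂ) ^ K / ((t : ℂ) - Complex.I * y) ∂σ := fun K hK y hy =>
    eq_integral_pow_div (hz y hy) (a := fun K => a K y) (h0 y hy) (fun K => hrec K y hy) K hK
  have hmom : ∀ K < 2 * n + 1, (∀ j < K, Integrable (fun t : ℝ => (t : ℂ) ^ j) σ ∧
      ∫ t : ℝ, (t : ℂ) ^ j ∂σ = s j) → Integrable (fun t : ℝ => (t : ℂ) ^ K) σ →
      ∀ j < K + 1, Integrable (fun t : ℝ => (t : ℂ) ^ j) σ ∧ ∫ t : ℝ, (t : ℂ) ^ j ∂σ = s j := by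
    intro K hKn hK hi j hj
    rcases Nat.lt_succ_iff_lt_or_eq.1 hj with hj | rfl
    · exact hK j hj
    · exact ⟨hi, moment_eq_of_tendsto (fun y hy => (hrep j hK y hy).2) (hrec j)
        (hlim' _ hKn) hi⟩
  -- The induction gains two moments at a time: positivity gives the even one directly, and the odd
  -- one below it is then integrable by domination.
  suffices H : ∀ m ≤ n, ∀ j < 2 * m + 1, Integrable (fun t : ℝ => (t : ℂ) ^ j) σ ∧
      ∫ t : ℝ, (t : ℂ) ^ j ∂σ = s j from H n le_rfl
  intro m
  induction m with
  | zero => exact fun _ => hmom 0 (by omega) (by simp) (by simp)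
  | succ m ih =>
    intro hm
    have hK := ih (by omega)
    have hint : Integrable (fun t : ℝ => t ^ (2 * m + 2)) σ := by
      -- Two steps of the recursion give `a (2m+3) = -y² a (2m+1) + iy s (2m+1) + s (2m+2)`. The
      -- middle term has no real part because `s (2m+1)` is real.
      have hy2 : ∀ y : ℝ, 0 < y → Integrable (fun t : ℝ => y ^ 2 / (t ^ 2 + y ^ 2) * t ^ (2 * m + 2)) σ ∧
          ∫ t : ℝ, y ^ 2 / (t ^ 2 + y ^ 2) * t ^ (2 * m + 2) ∂σ =
            (s (2 * m + 2)).re - (a (2 * m + 3) y).re := by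
        intro y hy
        obtain ⟨hi, he⟩ := hrep _ hK y hy
        have h1 : (fun t : ℝ => y ^ 2 / (t ^ 2 + y ^ 2) * t ^ (2 * m + 2)) = fun t : ℝ =>
            y ^ 2 * ((t : ℂ) ^ (2 * m + 1) / ((t : ℂ) - Complex.I * y)).re := by
          ext t
          rw [re_pow_div_ofReal_sub hy]
          ring
        rw [h1]
        refine ⟨hi.re.const_mul _, ?_⟩
        rw [integral_const_mul, show ∫ t : ℝ, ((t : ℂ) ^ (2 * m + 1) /
          ((t : ℂ) - Complex.I * y)).re ∂σ = (a (2 * m + 1) y).re from by rw [he]; exact integral_re hi,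
          hrec (2 * m + 2) y hy, hrec (2 * m + 1) y hy]
        have h3 := him (2 * m + 1) (by omega)
        simp [h3]
        ring
      refine integrable_of_bounded_integral (by fun_prop)
        (fun t => (even_two_mul (m + 1)).pow_nonneg t)
        (C := (s (2 * m + 2)).re + 1) ?_ ?_
      · filter_upwards [eventually_gt_atTop 0] with y hy using (hy2 y hy).1
      · have h3 : Tendsto (fun y => (a (2 * m + 3) y).re) atTop (𝓝 0) :=
          (Complex.continuous_re.tendsto 0).comp (hlim' _ (by omega))
        filter_upwards [eventually_gt_atTop 0, h3.eventually (lt_mem_nhds neg_one_lt_zero)]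
          with y hy h4
        rw [(hy2 y hy).2]
        linarith
    have h1 := hmom (2 * m + 1) (by omega) hK
      (integrable_ofReal_pow.2 (integrable_pow_of_le (by omega) hint))
    exact hmom (2 * m + 2) (by omega) h1 (integrable_ofReal_pow.2 hint)

/-! ### Scalar Nevanlinna representations -/

lemma mul_im_integral_herglotzKernel (ν : Measure ℝ) [IsFiniteMeasure ν] {y : ℝ} (hy : 0 < y) :
    Integrable (fun t : ℝ => y ^ 2 / (t ^ 2 + y ^ 2) * (t ^ 2 + 1)) ν ∧
    ∫ t : ℝ, y ^ 2 / (t ^ 2 + y ^ 2) * (t ^ 2 + 1) ∂ν = y *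
      (∫ t : ℝ, (1 + (t : ℂ) * (Complex.I * y)) / ((t : ℂ) - Complex.I * y) ∂ν).im := by
  have hz : 0 < (Complex.I * (y : ℂ)).im := by simpa
  have hi := integrable_herglotzKernel ν hz
  have h1 : (fun t : ℝ => y ^ 2 / (t ^ 2 + y ^ 2) * (t ^ 2 + 1)) = fun t : ℝ =>
      y * ((1 + (t : ℂ) * (Complex.I * y)) / ((t : ℂ) - Complex.I * y)).im := by
    ext t
    rw [div_ofReal_sub_eq hy, Complex.div_ofReal_im]
    simp
    ring
  rw [h1]
  refine ⟨hi.im.const_mul _, ?_⟩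
  rw [integral_const_mul]
  congr 1
  exact integral_im hi

/-- Here `y Im f(iy)` is the sum of `y² β` and `∫ y²(t²+1)/(t²+y²) dν`. Both are non-negative, so
each is bounded: the first forces `β = 0`, and Fatou handles the second. -/
lemma integrable_of_bounded_mul_im {ν : Measure ℝ} [IsFiniteMeasure ν] {α : ℂ} {β C : ℝ}
    (hα : α.im = 0) (hβ : 0 ≤ β) {f : ℂ → ℂ}
    (hf : ∀ y : ℝ, 0 < y → f (Complex.I * y) = α + Complex.I * y * β +
      ∫ t : ℝ, (1 + (t : ℂ) * (Complex.I * y)) / ((t : ℂ) - Complex.I * y) ∂ν)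
    (hC : ∀ᶠ y : ℝ in atTop, y * (f (Complex.I * y)).im ≤ C) :
    β = 0 ∧ Integrable (fun t : ℝ => t ^ 2 + 1) ν := by
  have hC' : ∀ᶠ y : ℝ in atTop, 0 < y ∧
      y ^ 2 * β + ∫ t : ℝ, y ^ 2 / (t ^ 2 + y ^ 2) * (t ^ 2 + 1) ∂ν ≤ C := by
    filter_upwards [hC, eventually_gt_atTop 0] with y h hy
    refine ⟨hy, ?_⟩
    rw [hf y hy] at h
    rw [(mul_im_integral_herglotzKernel ν hy).2]
    simp only [Complex.add_im, hα, Complex.mul_im, Complex.mul_re, Complex.I_re, Complex.I_im,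
      Complex.ofReal_re, Complex.ofReal_im] at h
    linarith
  have hnn : ∀ y : ℝ, 0 ≤ ∫ t : ℝ, y ^ 2 / (t ^ 2 + y ^ 2) * (t ^ 2 + 1) ∂ν :=
    fun y => integral_nonneg fun t => by positivity
  constructor
  · by_contra hne
    have hpos : 0 < β := lt_of_le_of_ne hβ (Ne.symm hne)
    have h1 : Tendsto (fun y : ℝ => y ^ 2 * β) atTop atTop :=
      (tendsto_pow_atTop two_ne_zero).atTop_mul_const hpos
    obtain ⟨y, h2, h3⟩ := (hC'.and (h1.eventually (eventually_gt_atTop C))).exists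
    linarith [hnn y, h2.2]
  · refine integrable_of_bounded_integral (by fun_prop) (fun t => by positivity) (C := C) ?_ ?_
    · filter_upwards [eventually_gt_atTop 0] with y hy
        using (mul_im_integral_herglotzKernel ν hy).1
    · filter_upwards [hC'] with y hy
      have : 0 ≤ y ^ 2 * β := by positivity
      linarith [hy.2]

lemma integral_withDensity_sq_add_one (ν : Measure ℝ) (f : ℝ → ℂ) :
    ∫ t, f t ∂ν.withDensity (fun t => ENNReal.ofReal (t ^ 2 + 1)) =
      ∫ t : ℝ, ((t : ℂ) ^ 2 + 1) * f t ∂ν := by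
  rw [integral_withDensity_eq_integral_toReal_smul (by fun_prop)
    (.of_forall fun _ => ENNReal.ofReal_lt_top)]
  refine integral_congr_ae (.of_forall fun t => ?_)
  have h : (0 : ℝ) ≤ t ^ 2 + 1 := by positivity
  simp [ENNReal.toReal_ofReal h]

/-- Since `(t²+1)/(t-z) = (1+tz)/(t-z) + t`, the Herglotz kernel becomes a Cauchy kernel for the
spectral measure, up to the first moment that enters `γ_F`. -/
lemma integral_herglotzKernel_eq {ν : Measure ℝ} [IsFiniteMeasure ν]
    (hi : Integrable (fun t : ℝ => t ^ 2 + 1) ν) {z : ℂ} (hz : 0 < z.im) :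
    ∫ t : ℝ, (1 + (t : ℂ) * z) / ((t : ℂ) - z) ∂ν = -∫ t : ℝ, (t : ℂ) ^ 1 ∂ν +
      ∫ t : ℝ, 1 / ((t : ℂ) - z) ∂ν.withDensity (fun t => ENNReal.ofReal (t ^ 2 + 1)) := by
  have h2 : Integrable (fun t : ℝ => t ^ 2) ν := by
    refine (hi.sub (integrable_const (1 : ℝ))).congr (.of_forall fun t => ?_)
    simp
  have h1 : Integrable (fun t : ℝ => (t : ℂ) ^ 1) ν :=
    integrable_ofReal_pow.2 (integrable_pow_of_le one_le_two h2)
  rw [integral_withDensity_sq_add_one]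
  have h : (fun t : ℝ => ((t : ℂ) ^ 2 + 1) * (1 / ((t : ℂ) - z))) = fun t : ℝ =>
      (1 + (t : ℂ) * z) / ((t : ℂ) - z) + (t : ℂ) ^ 1 := by
    ext t
    have := ofReal_sub_ne_zero hz t
    field_simp
    ring
  rw [h, integral_add (integrable_herglotzKernel ν hz) h1]
  ring

lemma tendsto_integral_cauchyKernel (σ : Measure ℝ) [IsFiniteMeasure σ] :
    Tendsto (fun y : ℝ => ∫ t : ℝ, 1 / ((t : ℂ) - Complex.I * y) ∂σ) atTop (𝓝 0) := by
  refine tendsto_zero_of_mul_add (s := ∫ _ : ℝ, (1 : ℂ) ∂σ) (fun y _ => rfl) ?_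
  simpa using (tendsto_integral_mul_div (integrable_const (1 : ℂ))
    (σ := σ)).add_const (∫ _ : ℝ, (1 : ℂ) ∂σ)

/-- The integrand after multiplication by `z` has imaginary part `Im z · t^{2n+2}/|t-z|²`. -/
lemma im_mul_integral_odd_pow_nonneg {σ : Measure ℝ} {z : ℂ} (hz : 0 < z.im) {n : ℕ}
    (hi : Integrable (fun t : ℝ => (t : ℂ) ^ (2 * n + 1) / ((t : ℂ) - z)) σ) :
    0 ≤ (z * ∫ t : ℝ, (t : ℂ) ^ (2 * n + 1) / ((t : ℂ) - z) ∂σ).im := by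
  rw [← integral_const_mul]
  have h1 := integral_im (hi.const_mul z)
  simp only [RCLike.im_to_complex] at h1
  rw [← h1]
  refine integral_nonneg fun t => ?_
  have h2 := ofReal_sub_ne_zero hz t
  have h3 : z * ((t : ℂ) ^ (2 * n + 1) / ((t : ℂ) - z)) =
      ((t ^ (2 * n) / Complex.normSq ((t : ℂ) - z) : ℝ) : ℂ) *
        (z * t * (starRingEnd ℂ) ((t : ℂ) - z)) := by
    have h4 : ((Complex.normSq ((t : ℂ) - z) : ℝ) : ℂ) ≠ 0 := by
      exact_mod_cast (Complex.normSq_pos.2 h2).ne'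
    push_cast
    field_simp
    rw [← Complex.mul_conj]
    ring
  rw [Pi.zero_apply, h3, Complex.im_ofReal_mul]
  refine mul_nonneg (div_nonneg ((even_two_mul n).pow_nonneg t) (Complex.normSq_nonneg _)) ?_
  have h5 : (z * t * (starRingEnd ℂ) ((t : ℂ) - z)).im = t ^ 2 * z.im := by
    simp
    ring
  rw [h5]
  positivity

/-- By Tonelli it suffices that integrating `t^{2n+2}/(t²+y²)` over `y ≥ 1` produces at least a
multiple of `|t|^{2n+1}` for large `|t|`. -/
lemma integrable_odd_pow {σ : Measure ℝ} [IsFiniteMeasure σ] {n : ℕ} {b : ℝ → ℝ}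
    (hb : IntegrableOn b (Ici 1))
    (hi : ∀ y : ℝ, 0 < y → Integrable (fun t : ℝ => t ^ (2 * n + 2) / (t ^ 2 + y ^ 2)) σ)
    (hle : ∀ y : ℝ, 1 ≤ y → ∫ t : ℝ, t ^ (2 * n + 2) / (t ^ 2 + y ^ 2) ∂σ ≤ b y) :
    Integrable (fun t : ℝ => t ^ (2 * n + 1)) σ := by
  have hnn : ∀ t y : ℝ, 0 ≤ t ^ (2 * n + 2) / (t ^ 2 + y ^ 2) := fun t y =>
    div_nonneg ((even_two_mul (n + 1)).pow_nonneg t) (by positivity)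
  have h1 : ∫⁻ y in Ici (1 : ℝ), ∫⁻ t, ENNReal.ofReal (t ^ (2 * n + 2) / (t ^ 2 + y ^ 2)) ∂σ < ∞ := by
    refine lt_of_le_of_lt (setLIntegral_mono' (g := fun y => ‖b y‖ₑ) measurableSet_Ici
      fun y hy => ?_) hb.2
    have hy0 : 0 < y := lt_of_lt_of_le one_pos hy
    rw [← ofReal_integral_eq_lintegral_ofReal (hi y hy0) (.of_forall fun t => hnn t y)]
    rw [← ofReal_norm]
    exact ENNReal.ofReal_le_ofReal ((hle y hy).trans (le_abs_self _))
  rw [lintegral_lintegral_swap (by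
    refine Measurable.aemeasurable ?_
    simp only [Function.uncurry_def]
    fun_prop)] at h1
  -- For `|t| ≥ 1` only `y` in `[|t|, 2|t|]` is kept, where `t²+y² ≤ 5t²`; the summand `1` covers
  -- `|t| ≤ 1`.
  have h2 : ∀ t : ℝ, ‖t ^ (2 * n + 1)‖ₑ ≤
      5 * (∫⁻ y in Ici (1 : ℝ), ENNReal.ofReal (t ^ (2 * n + 2) / (t ^ 2 + y ^ 2))) + 1 := by
    intro t
    rw [← ofReal_norm, norm_pow, Real.norm_eq_abs]
    rcases le_total |t| 1 with ht | ht
    · refine le_trans ?_ le_add_self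
      rw [ENNReal.ofReal_le_one]
      exact pow_le_one₀ (abs_nonneg t) ht
    · refine le_trans ?_ le_self_add
      have h0 : 0 < |t| := by linarith
      have h3 : ENNReal.ofReal (|t| ^ (2 * n) / 5) * ENNReal.ofReal |t| ≤
          ∫⁻ y in Ici (1 : ℝ), ENNReal.ofReal (t ^ (2 * n + 2) / (t ^ 2 + y ^ 2)) := by
        have h4 : ENNReal.ofReal |t| = volume (Icc |t| (2 * |t|)) := by
          rw [Real.volume_Icc]; congr 1; ring
        rw [h4, ← setLIntegral_const]
        refine (setLIntegral_mono' measurableSet_Icc fun y hy => ?_).trans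
          (lintegral_mono_set (Icc_subset_Ici_self.trans (Ici_subset_Ici.2 ht)))
        refine ENNReal.ofReal_le_ofReal ?_
        have hy2 : y ^ 2 ≤ 4 * |t| ^ 2 := by nlinarith [hy.1, hy.2]
        have hpe : t ^ (2 * n + 2) = |t| ^ (2 * n + 2) := ((even_two_mul (n + 1)).pow_abs t).symm
        rw [hpe, ← sq_abs t, div_le_div_iff₀ (by norm_num) (by positivity), pow_add]
        have : 0 ≤ |t| ^ (2 * n) := by positivity
        nlinarith
      rw [← ENNReal.ofReal_mul (by positivity)] at h3
      refine le_trans (le_of_eq ?_) (mul_le_mul' le_rfl h3)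
      rw [show (5 : ℝ≥0∞) = ENNReal.ofReal 5 by simp, ← ENNReal.ofReal_mul (by norm_num)]
      congr 1
      ring
  refine ⟨Measurable.aestronglyMeasurable (by fun_prop), ?_⟩
  refine (lintegral_mono h2).trans_lt ?_
  rw [lintegral_add_right _ measurable_const, lintegral_const_mul' _ _ (by simp)]
  exact ENNReal.add_lt_top.2 ⟨ENNReal.mul_lt_top (by simp) h1, by simp⟩

/-! ### The functions `F^{<k>}` -/

lemma shifted_neg_one (s : ℤ → CMat q) (F : ℂ → CMat q) (z : ℂ) :
    shifted s (-1) F z = F z + s (-1) := by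
  simp [shifted]

lemma shifted_add_one (s : ℤ → CMat q) (F : ℂ → CMat q) {z : ℂ} (hz : z ≠ 0) (k : ℕ) :
    shifted s k F z = z • shifted s (k - 1) F z + s k := by
  have h : Finset.Icc (0 : ℤ) (k + 1) = insert ((k : ℤ) + 1) (Finset.Icc (0 : ℤ) k) := by
    ext j
    simp only [Finset.mem_Icc, Finset.mem_insert]
    omega
  rw [shifted, shifted, h, Finset.sum_insert (by simp), sub_add_cancel, smul_add, smul_smul,
    ← zpow_one_add₀ hz, Finset.smul_sum]
  simp only [smul_smul, ← zpow_one_add₀ hz]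
  rw [show (1 : ℤ) + k = k + 1 by ring]
  simp only [sub_self, zpow_zero, one_smul, add_sub_cancel_right,
    fun j : ℤ => show (1 : ℤ) + (k - j) = k + 1 - j by ring]
  abel

lemma im_I_mul_pos {y : ℝ} (hy : 0 < y) : 0 < (Complex.I * (y : ℂ)).im := by simpa

lemma upperHalf_ne_zero {z : ℂ} (hz : 0 < z.im) : z ≠ 0 := by
  rintro rfl; simp at hz

/-- Indexing by `K = k + 1` starts the sequence at `F^{<-1>} = F + s_{-1}` and gives exactly the
recursion required by `eq_integral_pow_div`. -/
lemma quad_shifted_succ (s : ℤ → CMat q) (F : ℂ → CMat q) (v : Fin q → ℂ) {z : ℂ} (hz : 0 < z.im)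
    (K : ℕ) : quad v (shifted s (((K + 1 : ℕ) : ℤ) - 1) F z) =
      z * quad v (shifted s ((K : ℤ) - 1) F z) + quad v (s K) := by
  rw [show (((K + 1 : ℕ) : ℤ) - 1) = K by push_cast; ring,
    shifted_add_one s F (upperHalf_ne_zero hz), map_add, quad_smul]

/-! ### The spectral measure -/

/-- `F` is, up to the constant `γ_F`, the Cauchy transform of its spectral measure. -/
def IsCauchyTransform (F : ℂ → CMat q) : Prop :=
  (gamma F).IsHermitian ∧ ∃ hσ : spectralMeasure F ∈ hermMeasures q, ∀ v z, 0 < z.im →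
    quad v (F z) = quad v (gamma F) + ∫ t : ℝ, 1 / ((t : ℂ) - z) ∂quadMeasure hσ v

lemma isNevanlinnaParam_nevanlinnaParam {F : ℂ → CMat q} (h : ∃ p, IsNevanlinnaParam F p) :
    IsNevanlinnaParam F (nevanlinnaParam F) := by
  rw [nevanlinnaParam, dif_pos h]
  exact h.choose_spec

lemma quad_ofReal_re {A : CMat q} (hA : A.IsHermitian) (v : Fin q → ℂ) :
    (((quad v A).re : ℝ) : ℂ) = quad v A :=
  Complex.ext (by simp) (by simp [isHermitian_iff_quad.1 hA v])

lemma integrable_of_quadMeasure_integrable_sq_add_one {ν : VectorMeasure ℝ (CMat q)}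
    (hν : ν ∈ hermMeasures q)
    (h : ∀ v, Integrable (fun t : ℝ => t ^ 2 + 1) (quadMeasure hν v)) :
    ν.Integrable fun t : ℝ => ((t ^ 2 + 1 : ℝ) : ℂ) :=
  (integrable_iff_quadMeasure hν).2 fun v => (h v).ofReal

/-- The bound is only eventual, one-sided and separate for each `v`; this is what the asymptotic
hypotheses provide before membership in `R_q^{[0]}` is known. -/
lemma isCauchyTransform_of_bounded {F : ℂ → CMat q} (hF : ∃ p, IsNevanlinnaParam F p)
    (hC : ∀ v, ∃ C : ℝ, ∀ᶠ y : ℝ in atTop, y * (quad v (F (Complex.I * y))).im ≤ C) :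
    IsCauchyTransform F := by
  have hp := isNevanlinnaParam_nevanlinnaParam hF
  have hν : nu F ∈ hermMeasures q := hp.nu_mem
  have hrep : ∀ v z, 0 < z.im → quad v (F z) = quad v (alpha F) +
      z * ((quad v (nevanlinnaParam F).2.1).re : ℝ) +
      ∫ t : ℝ, (1 + (t : ℂ) * z) / ((t : ℂ) - z) ∂quadMeasure hν v := by
    intro v z hz
    rw [hp.eq_integral z hz, map_add, map_add, quad_smul,
      quad_ofReal_re hp.beta_nonneg.isHermitian]
    exact congrArg _ (quad_matInt hν v
      ((integrable_iff_quadMeasure hν).2 fun v => integrable_herglotzKernel _ hz))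
  have hb : ∀ v, (quad v (nevanlinnaParam F).2.1).re = 0 ∧
      Integrable (fun t : ℝ => t ^ 2 + 1) (quadMeasure hν v) := by
    intro v
    obtain ⟨C, hC⟩ := hC v
    exact integrable_of_bounded_mul_im (f := fun z => quad v (F z)) (isHermitian_iff_quad.1 hp.alpha_hermitian v)
      (Complex.nonneg_iff.1 (posSemidef_iff_quad.1 hp.beta_nonneg v)).1
      (fun y hy => hrep v _ (im_I_mul_pos hy)) hC
  have hint := integrable_of_quadMeasure_integrable_sq_add_one hν fun v => (hb v).2
  have hspec : spectralMeasure F = VectorMeasure.withDensity (nu F)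
      (fun t : ℝ => ((t ^ 2 + 1 : ℝ) : ℂ)) (scalarPairing q) := by
    simp [spectralMeasure]
  have h0 : ∀ t : ℝ, 0 ≤ t ^ 2 + 1 := fun t => by positivity
  have hsq : ∀ v, Integrable (fun t : ℝ => t ^ 1) (quadMeasure hν v) := fun v => by
    refine integrable_pow_of_le one_le_two ?_
    refine ((hb v).2.sub (integrable_const (1 : ℝ))).congr (.of_forall fun t => ?_)
    simp
  have hmom : ∀ v, quad v (moment (nu F) 1) = ((∫ t : ℝ, t ^ 1 ∂quadMeasure hν v : ℝ) : ℂ) := by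
    intro v
    rw [moment, quad_matInt hν v
      ((integrable_iff_quadMeasure hν).2 fun v => integrable_ofReal_pow.2 (hsq v)),
      ← integral_complex_ofReal]
    simp only [Complex.ofReal_pow]
  unfold IsCauchyTransform
  rw [hspec]
  refine ⟨?_, withDensity_mem_hermMeasures hν hint h0, fun v z hz => ?_⟩
  · rw [isHermitian_iff_quad]
    intro v
    rw [gamma, map_sub, hmom, Complex.sub_im, Complex.ofReal_im, sub_zero]
    exact isHermitian_iff_quad.1 hp.alpha_hermitian v
  · rw [quadMeasure_withDensity hν hint h0, hrep v z hz, (hb v).1,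
      integral_herglotzKernel_eq (hb v).2 hz, gamma, map_sub, hmom, ← integral_complex_ofReal]
    simp only [Complex.ofReal_pow]
    simp only [Complex.ofReal_zero, mul_zero, add_zero]
    ring

lemma isCauchyTransform_of_mem_nevanlinnaZero {F : ℂ → CMat q} (hF : ∃ p, IsNevanlinnaParam F p)
    (h : F ∈ nevanlinnaZero q) : IsCauchyTransform F := by
  obtain ⟨-, C, hC⟩ := h
  refine isCauchyTransform_of_bounded hF fun v => ⟨‖quad v‖ * C, ?_⟩
  filter_upwards [eventually_ge_atTop 1] with y hy
  have h1 : (quad v (F (Complex.I * y))).im ≤ ‖quad v‖ * ‖imPart (F (Complex.I * y))‖ := by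
    refine le_trans ?_ ((quad v).le_opNorm _)
    rw [quad_imPart, Complex.norm_real]
    exact le_abs_self _
  calc y * (quad v (F (Complex.I * y))).im
      ≤ y * (‖quad v‖ * ‖imPart (F (Complex.I * y))‖) := by gcongr
    _ = ‖quad v‖ * (y * ‖imPart (F (Complex.I * y))‖) := by ring
    _ ≤ ‖quad v‖ * C := by gcongr; exact hC y hy

lemma IsCauchyTransform.mem_nevanlinnaZero {F : ℂ → CMat q} (hF : F ∈ nevanlinna q)
    (h : IsCauchyTransform F) : F ∈ nevanlinnaZero q := by
  obtain ⟨hγ, hσ, hrep⟩ := h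
  refine ⟨hF, ∑ a, (quadMeasure hσ (polVec a)).real univ * ‖polMat (q := q) a‖, fun y hy => ?_⟩
  have hy0 : 0 < y := by linarith
  refine (mul_le_mul_of_nonneg_left (norm_le_sum_quad _) hy0.le).trans ?_
  rw [Finset.mul_sum]
  refine Finset.sum_le_sum fun a _ => ?_
  rw [← mul_assoc]
  refine mul_le_mul_of_nonneg_right ?_ (norm_nonneg _)
  have hz := im_I_mul_pos hy0
  rw [quad_imPart, hrep _ _ hz, Complex.add_im, isHermitian_iff_quad.1 hγ, zero_add,
    Complex.norm_real]
  refine (mul_le_mul_of_nonneg_left (Complex.abs_im_le_norm _) hy0.le).trans ?_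
  have h1 : ‖∫ t : ℝ, 1 / ((t : ℂ) - Complex.I * y) ∂quadMeasure hσ (polVec a)‖ ≤
      y⁻¹ * (quadMeasure hσ (polVec a)).real univ := by
    refine norm_integral_le_of_norm_le_const (.of_forall fun t => ?_)
    rw [norm_div, norm_one, one_div]
    have := im_pos_le_norm_ofReal_sub t (Complex.I * y)
    exact inv_anti₀ hy0 (by simpa using this)
  refine (mul_le_mul_of_nonneg_left h1 hy0.le).trans (le_of_eq ?_)
  field_simp

/-! ### The Herglotz formula in the unit disc -/

lemma mul_mem_ball_of_mem_closedBall {r : ℝ} (hr : 0 ≤ r) (hr1 : r < 1) {w : ℂ}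
    (hw : w ∈ Metric.closedBall (0 : ℂ) 1) : (r : ℂ) * w ∈ Metric.ball (0 : ℂ) 1 := by
  rw [mem_closedBall_zero_iff] at hw
  rw [mem_ball_zero_iff, norm_mul, Complex.norm_real, Real.norm_of_nonneg hr]
  nlinarith [norm_nonneg w]

/-- By the Poisson formula the circle average has the same real part as `g`. Two analytic functions
with equal real parts differ by a constant, which is read off at `0`, where the kernel is `1`. -/
lemma herglotz_formula {g : ℂ → ℂ} (hg : DiffContOnCl ℂ g (Metric.ball 0 1)) {w : ℂ}
    (hw : w ∈ Metric.ball (0 : ℂ) 1) :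
    g w = Complex.I * (g 0).im +
      Real.circleAverage (fun ζ => herglotzRieszKernel 0 w ζ • ((g ζ).re : ℂ)) 0 1 := by
  have hcont : ContinuousOn g (Metric.sphere 0 1) := hg.continuousOn_ball.mono
    Metric.sphere_subset_closedBall
  have hci : CircleIntegrable g 0 1 := hcont.circleIntegrable zero_le_one
  have hre : CircleIntegrable (fun ζ => (g ζ).re) 0 1 :=
    (Complex.continuous_re.comp_continuousOn hcont).circleIntegrable zero_le_one
  have hrec : CircleIntegrable (fun ζ => ((g ζ).re : ℂ)) 0 1 :=
    (Complex.continuous_ofReal.comp_continuousOn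
      (Complex.continuous_re.comp_continuousOn hcont)).circleIntegrable zero_le_one
  set G : ℂ → ℂ := fun w =>
    Real.circleAverage (fun ζ => herglotzRieszKernel 0 w ζ • ((g ζ).re : ℂ)) 0 1 with hG
  have hGre : ∀ w ∈ Metric.ball (0 : ℂ) 1, (G w).re = (g w).re := by
    intro w hw
    rw [hG]
    simp only
    rw [re_circleAverage_herglotzRieszKernel_smul hre hw]
    have h1 := hg.circleAverage_re_herglotzRieszKernel_smul hw
    have hk : ContinuousOn (Complex.re ∘ herglotzRieszKernel 0 w) (Metric.sphere 0 1) := by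
      have := continuousOn_herglotzRieszKernel_sphere (R := 1) hw
      rw [abs_one] at this
      exact Complex.continuous_re.comp_continuousOn this
    have h2 := Complex.reCLM.circleAverage_comp_comm
      (f := (Complex.re ∘ herglotzRieszKernel 0 w) • g) (c := 0) (R := 1)
      ((hk.smul hcont).circleIntegrable zero_le_one)
    rw [h1] at h2
    rw [Complex.reCLM_apply] at h2
    rw [← h2]
    congr 1
    ext ζ
    simp
  have hGd : AnalyticOnNhd ℂ G (Metric.ball 0 1) :=
    analyticOnNhd_circleAverage_herglotzRieszKernel_smul hrec
  have hgd : AnalyticOnNhd ℂ g (Metric.ball 0 1) :=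
    hg.differentiableOn.analyticOnNhd Metric.isOpen_ball
  obtain ⟨c, hc⟩ := (hgd.sub hGd).eq_const_of_re_eq_const (c₀ := 0)
    (fun x hx => by simp [hGre x hx]) Metric.isOpen_ball
    (Metric.isConnected_ball one_pos)
  have h0 : (0 : ℂ) ∈ Metric.ball (0 : ℂ) 1 := by simp
  have hG0 : (G 0).im = 0 := by
    have h3 : G 0 = Real.circleAverage (fun ζ => ((g ζ).re : ℂ)) 0 1 := by
      refine Real.circleAverage_congr_sphere fun ζ hζ => ?_
      have : ζ ≠ 0 := by
        rintro rfl; simp at hζ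
      simp [herglotzRieszKernel_def, this]
    have h4 := Complex.imCLM.circleAverage_comp_comm hrec
    rw [h3, ← Complex.imCLM_apply, ← h4]
    simp [Function.comp_def, Real.circleAverage_const]
  have h5 := hc 0 h0
  have h6 := hc w hw
  simp only [Pi.sub_apply] at h5 h6
  have h7 : c = Complex.I * (g 0).im := by
    rw [← h5]
    refine Complex.ext ?_ ?_
    · simp [hGre 0 h0]
    · simp [hG0]
  rw [← h7, ← h6]
  ring

/-! ### The Cayley transform -/

/-- The Cayley transform of the unit disc onto the upper half plane. -/
def cayley (w : ℂ) : ℂ := Complex.I * (1 + w) / (1 - w)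

lemma one_sub_ne_zero_of_mem_ball {w : ℂ} (hw : w ∈ Metric.ball (0 : ℂ) 1) : 1 - w ≠ 0 := by
  intro h
  rw [mem_ball_zero_iff, ← sub_eq_zero.1 h] at hw
  simp at hw

lemma cayley_im_pos {w : ℂ} (hw : w ∈ Metric.ball (0 : ℂ) 1) : 0 < (cayley w).im := by
  have h1 := one_sub_ne_zero_of_mem_ball hw
  have h2 : Complex.normSq w < 1 := by
    rw [mem_ball_zero_iff] at hw
    rw [Complex.normSq_eq_norm_sq]
    nlinarith [norm_nonneg w]
  have h3 : 0 < Complex.normSq (1 - w) := Complex.normSq_pos.2 h1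
  have h4 : (cayley w).im = (1 - Complex.normSq w) / Complex.normSq (1 - w) := by
    rw [cayley, Complex.div_im, ← sub_div]
    congr 1
    simp [Complex.normSq_apply]
    ring
  rw [h4]
  exact div_pos (by linarith) h3

lemma differentiableOn_cayley : DifferentiableOn ℂ cayley (Metric.ball 0 1) := by
  unfold cayley
  refine DifferentiableOn.div (by fun_prop) (by fun_prop) fun w hw => ?_
  exact one_sub_ne_zero_of_mem_ball hw

lemma cayley_zero : cayley 0 = Complex.I := by simp [cayley]

/-- The preimage of a point of the upper half plane under the Cayley transform. -/
def cayleyInv (z : ℂ) : ℂ := (z - Complex.I) / (z + Complex.I)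

lemma add_I_ne_zero {z : ℂ} (hz : 0 ≤ z.im) : z + Complex.I ≠ 0 := by
  intro h
  have := congrArg Complex.im h
  simp at this
  linarith

lemma cayley_cayleyInv {z : ℂ} (hz : 0 < z.im) : cayley (cayleyInv z) = z := by
  have h1 := add_I_ne_zero hz.le
  have hI := Complex.I_ne_zero
  have h2 : 1 - cayleyInv z = 2 * Complex.I / (z + Complex.I) := by
    rw [cayleyInv]; field_simp; ring
  have h3 : 1 + cayleyInv z = 2 * z / (z + Complex.I) := by
    rw [cayleyInv]; field_simp; ring
  rw [cayley, h2, h3]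
  field_simp

lemma cayleyInv_mem_ball {z : ℂ} (hz : 0 < z.im) : cayleyInv z ∈ Metric.ball (0 : ℂ) 1 := by
  have h1 := add_I_ne_zero hz.le
  rw [mem_ball_zero_iff, cayleyInv, norm_div, div_lt_one (norm_pos_iff.2 h1), ← sq_lt_sq₀
    (norm_nonneg _) (norm_nonneg _), ← Complex.normSq_eq_norm_sq, ← Complex.normSq_eq_norm_sq]
  simp [Complex.normSq_apply]
  nlinarith

/-- The real point corresponding to `exp (iθ)` under the Cayley transform. -/
def cayleyAngle (θ : ℝ) : ℝ := -(Real.cos (θ / 2) / Real.sin (θ / 2))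

lemma measurable_cayleyAngle : Measurable cayleyAngle := by
  unfold cayleyAngle; fun_prop

lemma circleMap_eq_cayleyInv {θ : ℝ} (hθ : θ ∈ Ioo 0 (2 * Real.pi)) :
    circleMap 0 1 θ = cayleyInv (cayleyAngle θ) := by
  have hs : Real.sin (θ / 2) ≠ 0 :=
    (Real.sin_pos_of_pos_of_lt_pi (by linarith [hθ.1]) (by linarith [hθ.2])).ne'
  have hs' : ((Real.sin (θ / 2) : ℝ) : ℂ) ≠ 0 := by exact_mod_cast hs
  have h1 : ((cayleyAngle θ : ℝ) : ℂ) + Complex.I ≠ 0 := add_I_ne_zero (by simp)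
  have h2 : circleMap 0 1 θ = ((Real.cos (θ / 2) : ℝ) + (Real.sin (θ / 2) : ℝ) * Complex.I) ^ 2 := by
    rw [circleMap, Complex.ofReal_cos, Complex.ofReal_sin, ← Complex.exp_mul_I, ← Complex.exp_nat_mul]
    simp
    congr 1
    ring
  have h3 : ((Real.cos (θ / 2) : ℝ) : ℂ) ^ 2 + ((Real.sin (θ / 2) : ℝ) : ℂ) ^ 2 = 1 := by
    exact_mod_cast Real.cos_sq_add_sin_sq (θ / 2)
  rw [cayleyInv, eq_div_iff h1, h2, cayleyAngle]
  push_cast at hs' h3 ⊢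
  set c := Complex.cos (θ / 2)
  set s := Complex.sin (θ / 2)
  field_simp
  linear_combination (-(c + s * Complex.I)) * h3 +
    (c * s ^ 2 + s ^ 3 * Complex.I) * Complex.I_sq

lemma I_mul_herglotzRieszKernel {z : ℂ} (hz : 0 < z.im) (t : ℝ) :
    Complex.I * herglotzRieszKernel 0 (cayleyInv z) (cayleyInv t) =
      (1 + (t : ℂ) * z) / ((t : ℂ) - z) := by
  have h1 := add_I_ne_zero hz.le
  have h2 : (t : ℂ) + Complex.I ≠ 0 := add_I_ne_zero (by simp)
  have h3 := ofReal_sub_ne_zero hz t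
  have hI := Complex.I_ne_zero
  have h4 : cayleyInv t + cayleyInv z =
      2 * (1 + t * z) / ((t + Complex.I) * (z + Complex.I)) := by
    rw [cayleyInv, cayleyInv]
    field_simp
    linear_combination (-2 : ℂ) * Complex.I_sq
  have h5 : cayleyInv t - cayleyInv z =
      2 * Complex.I * (t - z) / ((t + Complex.I) * (z + Complex.I)) := by
    rw [cayleyInv, cayleyInv]
    field_simp
    ring
  rw [herglotzRieszKernel_def, sub_zero, sub_zero, h4, h5]
  field_simp

/-- The boundary point `1` corresponds to infinity; mass there is the source of the linear term `z
β`. -/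
lemma I_mul_herglotzRieszKernel_one {z : ℂ} (hz : 0 < z.im) :
    Complex.I * herglotzRieszKernel 0 (cayleyInv z) 1 = z := by
  conv_rhs => rw [← cayley_cayleyInv hz]
  rw [herglotzRieszKernel_def, cayley, sub_zero, sub_zero, mul_div_assoc]

lemma continuous_herglotzRieszKernel_circleMap {w : ℂ} (hw : w ∈ Metric.ball (0 : ℂ) 1) :
    Continuous fun θ : ℝ => herglotzRieszKernel 0 w (circleMap 0 1 θ) := by
  have := continuousOn_herglotzRieszKernel_sphere (R := 1) hw
  exact this.comp_continuous (continuous_circleMap 0 1) fun θ => circleMap_mem_sphere' 0 1 θ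

lemma norm_herglotzRieszKernel_circleMap_le {w : ℂ} (hw : w ∈ Metric.ball (0 : ℂ) 1) (θ : ℝ) :
    ‖herglotzRieszKernel 0 w (circleMap 0 1 θ)‖ ≤ 2 / (1 - ‖w‖) := by
  rw [mem_ball_zero_iff] at hw
  have h1 : ‖circleMap 0 1 θ‖ = 1 := by simp
  rw [herglotzRieszKernel_def, sub_zero, sub_zero, norm_div]
  have h2 : 1 - ‖w‖ ≤ ‖circleMap 0 1 θ - w‖ := by
    have := norm_sub_norm_le (circleMap 0 1 θ) w
    rwa [h1] at this
  refine div_le_div₀ zero_le_two ?_ (by linarith) h2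
  refine (norm_add_le _ _).trans ?_
  rw [h1]; linarith

/-! ### Families indexed by vectors that are quadratic forms -/

/-- The values `c v` form a quadratic form; stated as the polarization identity. -/
def IsQuadForm (c : (Fin q → ℂ) → ℂ) : Prop :=
  ∀ v, c v = ∑ a, c (polVec a) * quad v (polMat a)

lemma isQuadForm_quad (A : CMat q) : IsQuadForm fun v => quad v A := fun v => by
  conv_lhs => rw [← polarization A]
  simp only [map_sum, quad_smul]

/-- The matrix of a quadratic form. -/
def matOfQuadForm (c : (Fin q → ℂ) → ℂ) : CMat q := ∑ a, c (polVec a) • polMat a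

lemma IsQuadForm.quad_matOfQuadForm {c : (Fin q → ℂ) → ℂ} (hc : IsQuadForm c) (v : Fin q → ℂ) :
    quad v (matOfQuadForm c) = c v := by
  rw [hc v, matOfQuadForm, map_sum]
  simp only [quad_smul]

/-- For each `v` the defining identity is linear in finitely many values of `c`, so it survives
integration and, below, pointwise limits. -/
lemma IsQuadForm.integral {X : Type*} [MeasurableSpace X] {μ : Measure X}
    {c : X → (Fin q → ℂ) → ℂ} (hc : ∀ x, IsQuadForm (c x))
    (hi : ∀ v, Integrable (fun x => c x v) μ) : IsQuadForm fun v => ∫ x, c x v ∂μ := by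
  intro v
  simp only [hc _ v]
  rw [integral_finsetSum _ fun a _ => (hi _).mul_const _]
  simp only [integral_mul_const]

lemma IsQuadForm.of_tendsto {ι : Type*} {l : Filter ι} [l.NeBot] {c : ι → (Fin q → ℂ) → ℂ}
    {c' : (Fin q → ℂ) → ℂ} (hc : ∀ i, IsQuadForm (c i))
    (h : ∀ v, Tendsto (fun i => c i v) l (𝓝 (c' v))) : IsQuadForm c' := by
  intro v
  refine tendsto_nhds_unique (h v) ?_
  simp only [fun i => hc i v]
  exact tendsto_finsetSum _ fun a _ => (h _).mul_const _

/-- Indicators are approximated in `L¹` by bounded continuous functions. The sum `τ` of all measures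
in the identity lets a single function serve for every term. -/
lemma isQuadForm_measureReal {μ : (Fin q → ℂ) → Measure ℝ} [∀ v, IsFiniteMeasure (μ v)]
    (h : ∀ f : BoundedContinuousFunction ℝ ℝ, IsQuadForm fun v => ((∫ t, f t ∂μ v : ℝ) : ℂ))
    {B : Set ℝ} (hB : MeasurableSet B) : IsQuadForm fun v => ((μ v).real B : ℂ) := by
  intro v
  set τ : Measure ℝ := μ v + ∑ a, μ (polVec a) with hτ
  have h1 : μ v ≤ τ := Measure.le_add_right le_rfl
  have h2 : ∀ a, μ (polVec a) ≤ τ := fun a =>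
    Measure.le_add_left (Measure.le_iff.2 fun s _ => by
      rw [Measure.coe_finsetSum, Finset.sum_apply]
      exact Finset.single_le_sum (f := fun a => μ (polVec a) s) (fun _ _ => zero_le)
        (Finset.mem_univ a))
  rw [← sub_eq_zero, ← norm_le_zero_iff]
  set C : ℝ := 1 + ∑ a, ‖quad v (polMat a)‖ with hC
  have hCpos : 0 < C := by positivity
  refine le_of_forall_pos_le_add fun ε hε => ?_
  have hind : Integrable (B.indicator fun _ => (1 : ℝ)) τ := (integrable_const _).indicator hB
  obtain ⟨f, hf, hfi⟩ := hind.exists_boundedContinuous_integral_sub_le (div_pos hε hCpos)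
  have hd : ∀ m ≤ τ, |m.real B - ∫ t, f t ∂m| ≤ ε / C := by
    intro m hm
    have e : m.real B = ∫ t, B.indicator (fun _ => (1 : ℝ)) t ∂m := by
      rw [integral_indicator_const (1 : ℝ) hB]; simp
    rw [e, ← integral_sub (hind.mono_measure hm) (hfi.mono_measure hm),
      ← Real.norm_eq_abs]
    refine (norm_integral_le_integral_norm _).trans (le_trans ?_ hf)
    exact integral_mono_measure hm (.of_forall fun t => norm_nonneg _) (hind.sub hfi).norm
  have hf0 := h f v
  have e2 : ((μ v).real B : ℂ) - ∑ a, ((μ (polVec a)).real B : ℂ) * quad v (polMat a) =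
      (((μ v).real B - ∫ t, f t ∂μ v : ℝ) : ℂ) -
        ∑ a, (((μ (polVec a)).real B - ∫ t, f t ∂μ (polVec a) : ℝ) : ℂ) * quad v (polMat a) := by
    simp only [Complex.ofReal_sub, sub_mul, Finset.sum_sub_distrib]
    linear_combination hf0
  rw [e2, zero_add]
  refine (norm_sub_le _ _).trans ?_
  calc _ ≤ ε / C + ∑ a, ε / C * ‖quad v (polMat (q := q) a)‖ := by
        refine add_le_add (by rw [Complex.norm_real]; exact hd _ h1) ?_
        refine (norm_sum_le _ _).trans (Finset.sum_le_sum fun a _ => ?_)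
        rw [norm_mul, Complex.norm_real]
        exact mul_le_mul_of_nonneg_right (hd _ (h2 a)) (norm_nonneg _)
    _ = ε / C * C := by rw [← Finset.mul_sum, hC]; ring
    _ = ε := by field_simp
    _ ≤ ε := le_rfl

/-- A family of finite measures depending quadratically on a vector comes from a non-negative
Hermitian measure. -/
lemma exists_hermMeasure_of_isQuadForm {μ : (Fin q → ℂ) → Measure ℝ} [∀ v, IsFiniteMeasure (μ v)]
    (h : ∀ B, MeasurableSet B → IsQuadForm fun v => ((μ v).real B : ℂ)) :
    ∃ (σ : VectorMeasure ℝ (CMat q)) (hσ : σ ∈ hermMeasures q), ∀ v, quadMeasure hσ v = μ v := by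
  let L : Fin q × Fin q × Fin 4 → (ℝ →L[ℝ] CMat q) := fun a =>
    (ContinuousLinearMap.id ℝ ℝ).smulRight (polMat a)
  let σ : VectorMeasure ℝ (CMat q) := ∑ a, (μ (polVec a)).toSignedMeasure.mapRange
    (L a).toLinearMap.toAddMonoidHom (L a).continuous
  have hσB : ∀ B, MeasurableSet B → ∀ v, quad v (σ B) = ((μ v).real B : ℂ) := by
    intro B hB v
    rw [← (h B hB).quad_matOfQuadForm v, matOfQuadForm]
    congr 1
    rw [FunLike.coe_sum, Finset.sum_apply]
    refine Finset.sum_congr rfl fun a _ => ?_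
    change L a ((μ (polVec a)).toSignedMeasure B) = _
    rw [Measure.toSignedMeasure_apply_measurable hB]
    simp [L]
  have hσ : σ ∈ hermMeasures q := fun B hB => posSemidef_iff_quad.2 fun v => by
    rw [hσB B hB]
    exact_mod_cast measureReal_nonneg
  refine ⟨σ, hσ, fun v => Measure.ext fun B hB => ?_⟩
  rw [← ofReal_measureReal, ← ofReal_measureReal]
  congr 1
  have := quadMeasure_real hσ v hB
  rw [hσB B hB] at this
  exact_mod_cast this

/-! ### Boundary measures of functions with non-negative real part -/

/-- The measure on `(0, 2π]` with density `(2π)⁻¹ Re g (exp (iθ))`. -/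
def boundaryMeasure (g : ℂ → ℂ) : Measure ℝ :=
  (volume.restrict (Ioc 0 (2 * Real.pi))).withDensity
    fun θ => ENNReal.ofReal ((2 * Real.pi)⁻¹ * (g (circleMap 0 1 θ)).re)

lemma continuous_boundaryDensity {g : ℂ → ℂ} (hg : ContinuousOn g (Metric.sphere 0 1)) :
    Continuous fun θ : ℝ => (2 * Real.pi)⁻¹ * (g (circleMap 0 1 θ)).re :=
  continuous_const.mul (Complex.continuous_re.comp
    (hg.comp_continuous (continuous_circleMap 0 1) fun θ => by simp))

lemma isFiniteMeasure_boundaryMeasure {g : ℂ → ℂ} (hg : ContinuousOn g (Metric.sphere 0 1)) :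
    IsFiniteMeasure (boundaryMeasure g) :=
  isFiniteMeasure_withDensity_ofReal
    (((continuous_boundaryDensity hg).integrableOn_Icc (a := 0) (b := 2 * Real.pi)).mono_set
      Ioc_subset_Icc_self).2

lemma boundaryMeasure_compl_Icc (g : ℂ → ℂ) : boundaryMeasure g (Icc 0 (2 * Real.pi))ᶜ = 0 := by
  refine withDensity_absolutelyContinuous _ _ ?_
  rw [Measure.restrict_apply measurableSet_Icc.compl]
  convert! measure_empty (μ := (volume : Measure ℝ))
  ext x
  simp only [mem_inter_iff, mem_compl_iff, mem_empty_iff_false, iff_false, not_and]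
  exact fun h h' => h (Ioc_subset_Icc_self h')

lemma integral_boundaryMeasure {g : ℂ → ℂ} (hg : ContinuousOn g (Metric.sphere 0 1))
    (h0 : ∀ ζ ∈ Metric.sphere (0 : ℂ) 1, 0 ≤ (g ζ).re)
    {E : Type*} [NormedAddCommGroup E] [NormedSpace ℝ E] (f : ℝ → E) :
    ∫ θ, f θ ∂boundaryMeasure g =
      ∫ θ in Ioc 0 (2 * Real.pi), ((2 * Real.pi)⁻¹ * (g (circleMap 0 1 θ)).re) • f θ := by
  rw [boundaryMeasure, integral_withDensity_eq_integral_toReal_smul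
    ((continuous_boundaryDensity hg).measurable.ennreal_ofReal) (by simp)]
  refine integral_congr_ae (.of_forall fun θ => ?_)
  simp only
  rw [ENNReal.toReal_ofReal]
  exact mul_nonneg (by positivity) (h0 _ (by simp))

lemma integral_boundaryMeasure_circleMap {g : ℂ → ℂ} (hg : ContinuousOn g (Metric.sphere 0 1))
    (h0 : ∀ ζ ∈ Metric.sphere (0 : ℂ) 1, 0 ≤ (g ζ).re)
    (f : ℂ → ℂ) :
    ∫ θ, f (circleMap 0 1 θ) ∂boundaryMeasure g =
      Real.circleAverage (fun ζ => f ζ • ((g ζ).re : ℂ)) 0 1 := by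
  rw [integral_boundaryMeasure hg h0, Real.circleAverage_def,
    intervalIntegral.integral_of_le (by positivity), ← integral_smul]
  refine integral_congr_ae (.of_forall fun θ => ?_)
  simp only [Complex.real_smul, smul_eq_mul]
  push_cast
  ring

lemma diffContOnCl_comp_mul {h : ℂ → ℂ} (hd : DifferentiableOn ℂ h (Metric.ball 0 1)) {r : ℝ}
    (hr : 0 ≤ r) (hr1 : r < 1) : DiffContOnCl ℂ (fun w => h (r * w)) (Metric.ball 0 1) := by
  have hmap : MapsTo (fun w : ℂ => (r : ℂ) * w) (Metric.closedBall 0 1) (Metric.ball 0 1) :=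
    fun w hw => mul_mem_ball_of_mem_closedBall hr hr1 hw
  refine DifferentiableOn.diffContOnCl ?_
  rw [closure_ball _ one_ne_zero]
  exact hd.comp (by fun_prop) hmap

/-- An increasing sequence of radii converging to `1`. -/
def radius (n : ℕ) : ℝ := 1 - 1 / ((n : ℝ) + 2)

lemma radius_nonneg (n : ℕ) : 0 ≤ radius n := by
  rw [radius, sub_nonneg, div_le_one (by positivity)]
  linarith [n.cast_nonneg (α := ℝ)]

lemma radius_lt_one (n : ℕ) : radius n < 1 := by
  rw [radius]; linarith [show (0 : ℝ) < 1 / ((n : ℝ) + 2) by positivity]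

lemma tendsto_radius : Tendsto radius atTop (𝓝 1) := by
  have h : Tendsto (fun n : ℕ => (n : ℝ) + 2) atTop atTop :=
    tendsto_natCast_atTop_atTop.atTop_add tendsto_const_nhds
  unfold radius
  simpa using (tendsto_const_nhds (x := (1 : ℝ))).sub (h.const_div_atTop 1)

/-- The boundary measure of a holomorphic function with non-negative real part on the unit disc, as
a limit along a fixed ultrafilter of the boundary measures on smaller circles. -/
lemma exists_boundary_limit {h : ℂ → ℂ} (hd : DifferentiableOn ℂ h (Metric.ball 0 1))
    (h0 : ∀ w ∈ Metric.ball (0 : ℂ) 1, 0 ≤ (h w).re) :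
    ∃ μ : FiniteMeasure ℝ, (μ : Measure ℝ) (Icc 0 (2 * Real.pi))ᶜ = 0 ∧
      (∀ f : BoundedContinuousFunction ℝ ℝ,
        Tendsto (fun n => ∫ θ, f θ ∂boundaryMeasure fun w => h (radius n * w)) (hyperfilter ℕ)
          (𝓝 (∫ θ, f θ ∂(μ : Measure ℝ)))) ∧
      ∀ w ∈ Metric.ball (0 : ℂ) 1, h w = Complex.I * (h 0).im +
        ∫ θ, herglotzRieszKernel 0 w (circleMap 0 1 θ) ∂(μ : Measure ℝ) := by
  have hcl := fun n => diffContOnCl_comp_mul hd (radius_nonneg n) (radius_lt_one n)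
  have hc : ∀ n, ContinuousOn (fun w => h (radius n * w)) (Metric.sphere 0 1) := fun n =>
    (hcl n).continuousOn_ball.mono Metric.sphere_subset_closedBall
  have hre : ∀ n, ∀ ζ ∈ Metric.sphere (0 : ℂ) 1, 0 ≤ (h (radius n * ζ)).re := fun n ζ hζ =>
    h0 _ (mul_mem_ball_of_mem_closedBall (radius_nonneg n) (radius_lt_one n)
      (Metric.sphere_subset_closedBall hζ))
  have hform : ∀ n, ∀ w ∈ Metric.ball (0 : ℂ) 1, h (radius n * w) = Complex.I * (h 0).im +
      ∫ θ, herglotzRieszKernel 0 w (circleMap 0 1 θ)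
        ∂boundaryMeasure fun w => h (radius n * w) := by
    intro n w hw
    have := herglotz_formula (hcl n) hw
    rw [integral_boundaryMeasure_circleMap (hc n) (hre n) (herglotzRieszKernel 0 w), this]
    simp
  obtain ⟨m, hm⟩ : ∃ m : ℕ → FiniteMeasure ℝ,
      ∀ n, (m n : Measure ℝ) = boundaryMeasure fun w => h (radius n * w) :=
    ⟨fun n => ⟨_, isFiniteMeasure_boundaryMeasure (hc n)⟩, fun n => rfl⟩
  simp only [← hm] at hform ⊢
  -- At `w = 0` the kernel is `1`, so all approximating measures have the same mass. With the common
  -- support `[0, 2π]` this gives weak compactness.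
  have hmass : ∀ n, (m n : Measure ℝ).real univ = (h 0).re := by
    intro n
    have h1 := congrArg Complex.re (hform n 0 (by simp))
    have h2 : ∀ θ : ℝ, herglotzRieszKernel 0 0 (circleMap 0 1 θ) = 1 := fun θ => by
      simp [herglotzRieszKernel_def]
    simp only [h2, mul_zero] at h1
    simp at h1
    exact h1.symm
  have hK : ∀ n, m n ∈ {μ : FiniteMeasure ℝ |
      μ.mass ≤ (h 0).re.toNNReal ∧ μ (Icc 0 (2 * Real.pi))ᶜ = 0} := by
    intro n
    refine ⟨?_, ?_⟩
    · rw [← hmass n, measureReal_def, ENNReal.toReal, Real.toNNReal_coe]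
      exact le_rfl
    · rw [FiniteMeasure.null_iff_toMeasure_null, hm]
      exact boundaryMeasure_compl_Icc _
  have hcompact := isCompact_setOfPred_finiteMeasure_le_of_isCompact (h 0).re.toNNReal
    (isCompact_Icc (a := (0 : ℝ)) (b := 2 * Real.pi))
  obtain ⟨μ, hμ, hlim⟩ := hcompact.ultrafilter_le_nhds' ((hyperfilter ℕ).map m)
    (Ultrafilter.mem_map.2 (Filter.univ_mem' hK))
  have hlim : Tendsto m (hyperfilter ℕ) (𝓝 μ) := hlim
  refine ⟨μ, (FiniteMeasure.null_iff_toMeasure_null _ _).1 hμ.2,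
    FiniteMeasure.tendsto_iff_forall_integral_tendsto.1 hlim, fun w hw => ?_⟩
  let k : BoundedContinuousFunction ℝ ℂ := BoundedContinuousFunction.ofNormedAddCommGroup
    (fun θ => herglotzRieszKernel 0 w (circleMap 0 1 θ))
    (continuous_herglotzRieszKernel_circleMap hw) _ (norm_herglotzRieszKernel_circleMap_le hw)
  have h1 := (FiniteMeasure.tendsto_iff_forall_integral_rclike_tendsto ℂ).1 hlim k
  have h2 : Tendsto (fun n => h (radius n * w)) (hyperfilter ℕ) (𝓝 (h w)) := by
    have hr : Tendsto (fun n => (radius n : ℂ) * w) atTop (𝓝 w) := by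
      have := ((Complex.continuous_ofReal.tendsto 1).comp tendsto_radius).mul_const w
      simpa using this
    exact ((hd.continuousOn.continuousAt (Metric.isOpen_ball.mem_nhds hw)).tendsto.comp hr).mono_left
      Nat.hyperfilter_le_atTop
  refine tendsto_nhds_unique h2 ?_
  simp only [fun n => hform n w hw]
  exact tendsto_const_nhds.add h1

/-- The endpoints `0` and `2π` both map to the circle point `1` and contribute the linear term. On
the open interval the circle is carried to the real line by `cayleyAngle`. -/
lemma integral_herglotzRieszKernel_eq {μ : Measure ℝ} [IsFiniteMeasure μ]
    (hμ : μ (Icc 0 (2 * Real.pi))ᶜ = 0) {z : ℂ} (hz : 0 < z.im) :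
    Complex.I * ∫ θ, herglotzRieszKernel 0 (cayleyInv z) (circleMap 0 1 θ) ∂μ =
      z * (μ.real {0, 2 * Real.pi} : ℂ) +
        ∫ t, (1 + (t : ℂ) * z) / ((t : ℂ) - z)
          ∂(μ.restrict (Ioo 0 (2 * Real.pi))).map cayleyAngle := by
  have hpi : (0 : ℝ) ≤ 2 * Real.pi := by positivity
  have hw := cayleyInv_mem_ball hz
  have hint : Integrable (fun θ : ℝ => Complex.I *
      herglotzRieszKernel 0 (cayleyInv z) (circleMap 0 1 θ)) μ :=
    ((integrable_const (2 / (1 - ‖cayleyInv z‖))).mono'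
      (continuous_herglotzRieszKernel_circleMap hw).aestronglyMeasurable
      (.of_forall (norm_herglotzRieszKernel_circleMap_le hw))).const_mul _
  have hend : MeasurableSet ({0, 2 * Real.pi} : Set ℝ) := (Set.toFinite _).measurableSet
  have hres : μ.restrict (Icc 0 (2 * Real.pi)) = μ :=
    Measure.restrict_eq_self_of_ae_mem (by rw [ae_iff]; exact hμ)
  have hunion : Icc 0 (2 * Real.pi) = {0, 2 * Real.pi} ∪ Ioo 0 (2 * Real.pi) := by
    rw [union_comm]; exact (Ioo_union_both hpi).symm
  have hdisj : Disjoint ({0, 2 * Real.pi} : Set ℝ) (Ioo 0 (2 * Real.pi)) := by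
    rw [Set.disjoint_left]
    rintro x (rfl | rfl) h
    · exact lt_irrefl _ h.1
    · exact lt_irrefl _ h.2
  rw [← integral_const_mul]
  conv_lhs => rw [← hres, hunion]
  rw [setIntegral_union hdisj measurableSet_Ioo hint.integrableOn hint.integrableOn]
  congr 1
  · rw [setIntegral_congr_fun (g := fun _ => z) hend]
    · rw [setIntegral_const, Complex.real_smul, mul_comm]
    · rintro x (rfl | rfl)
      · have : circleMap 0 1 0 = 1 := by simp [circleMap]
        simp only [this, I_mul_herglotzRieszKernel_one hz]
      · have : circleMap 0 1 (2 * Real.pi) = 1 := by simp [circleMap]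
        simp only [this, I_mul_herglotzRieszKernel_one hz]
  · rw [integral_map measurable_cayleyAngle.aemeasurable]
    · refine setIntegral_congr_fun measurableSet_Ioo fun θ hθ => ?_
      rw [circleMap_eq_cayleyInv hθ, I_mul_herglotzRieszKernel hz]
    · exact Measurable.aestronglyMeasurable (by fun_prop)

/-! ### Nevanlinna representation of matrix functions -/

/-- The Nevanlinna representation. -/
lemma exists_isNevanlinnaParam {F : ℂ → CMat q} (hF : F ∈ nevanlinna q) :
    ∃ p, IsNevanlinnaParam F p := by
  set h : (Fin q → ℂ) → ℂ → ℂ := fun v w => -Complex.I * quad v (F (cayley w)) with hh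
  have hcayley : MapsTo cayley (Metric.ball 0 1) upperHalf := fun w hw => cayley_im_pos hw
  have hd : ∀ v, DifferentiableOn ℂ (h v) (Metric.ball 0 1) := fun v =>
    (((quad v).differentiable.comp_differentiableOn
      (hF.1.comp differentiableOn_cayley hcayley))).const_mul _
  have hre : ∀ v w, ((h v w).re : ℂ) = quad v (imPart (F (cayley w))) := fun v w => by
    rw [quad_imPart]; simp [hh]
  have h0 : ∀ v, ∀ w ∈ Metric.ball (0 : ℂ) 1, 0 ≤ (h v w).re := fun v w hw => by
    have := posSemidef_iff_quad.1 (hF.2 _ (hcayley hw)) v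
    rw [← hre] at this
    exact_mod_cast this
  -- The measures are chosen separately for each `v`, but `hlim` refers to the same ultrafilter for
  -- all of them, so polarization identities pass to the limit.
  choose μ hμ hlim hrep using fun v => exists_boundary_limit (hd v) (h0 v)
  have hquad : ∀ f : BoundedContinuousFunction ℝ ℝ,
      IsQuadForm fun v => ((∫ t, f t ∂(μ v : Measure ℝ) : ℝ) : ℂ) := by
    intro f
    refine IsQuadForm.of_tendsto (l := (hyperfilter ℕ : Filter ℕ)) (fun n => ?_) fun v =>
      (Complex.continuous_ofReal.tendsto _).comp (hlim v f)
    have hc : ∀ v, ContinuousOn (fun w => h v (radius n * w)) (Metric.sphere 0 1) := fun v =>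
      (diffContOnCl_comp_mul (hd v) (radius_nonneg n) (radius_lt_one n)).continuousOn_ball.mono
        Metric.sphere_subset_closedBall
    have hpos : ∀ v, ∀ ζ ∈ Metric.sphere (0 : ℂ) 1, 0 ≤ (h v (radius n * ζ)).re := fun v ζ hζ =>
      h0 v _ (mul_mem_ball_of_mem_closedBall (radius_nonneg n) (radius_lt_one n)
        (Metric.sphere_subset_closedBall hζ))
    have he : ∀ v, ((∫ θ, f θ ∂boundaryMeasure fun w => h v (radius n * w) : ℝ) : ℂ) =
        ∫ θ in Ioc 0 (2 * Real.pi), quad v ((((2 * Real.pi)⁻¹ * f θ : ℝ) : ℂ) •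
          imPart (F (cayley (radius n * circleMap 0 1 θ)))) := by
      intro v
      rw [integral_boundaryMeasure (hc v) (hpos v), ← integral_complex_ofReal]
      refine integral_congr_ae (.of_forall fun θ => ?_)
      simp only [quad_smul, ← hre, smul_eq_mul]
      push_cast
      ring
    simp only [Function.comp_apply, he]
    refine IsQuadForm.integral (fun θ => isQuadForm_quad _) fun v => ?_
    have hcont : Continuous fun θ : ℝ => (((2 * Real.pi)⁻¹ * f θ : ℝ) : ℂ) *
        ((h v (radius n * circleMap 0 1 θ)).re : ℂ) := by
      have h1 : Continuous fun θ : ℝ => h v (radius n * circleMap 0 1 θ) :=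
        (hc v).comp_continuous (continuous_circleMap 0 1) fun θ => by simp
      exact (Complex.continuous_ofReal.comp (continuous_const.mul f.continuous)).mul
        (Complex.continuous_ofReal.comp (Complex.continuous_re.comp h1))
    simp only [quad_smul, ← hre]
    exact (hcont.integrableOn_Icc (a := 0) (b := 2 * Real.pi)).mono_set Ioc_subset_Icc_self
  have hB : ∀ B, MeasurableSet B → IsQuadForm fun v => (((μ v : Measure ℝ).real B : ℝ) : ℂ) :=
    fun B hB => isQuadForm_measureReal hquad hB
  have hν : ∀ B, MeasurableSet B → IsQuadForm fun v =>
      ((((μ v : Measure ℝ).restrict (Ioo 0 (2 * Real.pi))).map cayleyAngle).real B : ℂ) := by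
    intro B hBm
    have := hB (cayleyAngle ⁻¹' B ∩ Ioo 0 (2 * Real.pi))
      ((measurable_cayleyAngle hBm).inter measurableSet_Ioo)
    refine (congrArg IsQuadForm (funext fun v => ?_)).mpr this
    rw [map_measureReal_apply measurable_cayleyAngle hBm,
      measureReal_restrict_apply (measurable_cayleyAngle hBm)]
  obtain ⟨ν, hνm, hνq⟩ := exists_hermMeasure_of_isQuadForm hν
  set b : (Fin q → ℂ) → ℂ := fun v => (((μ v : Measure ℝ).real {0, 2 * Real.pi} : ℝ) : ℂ) with hb
  have hbq : IsQuadForm b := hB _ (Set.toFinite _).measurableSet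
  -- The centre of the disc corresponds to `i`, so the constant of the Herglotz formula becomes the
  -- Hermitian part of `F(i)`.
  obtain ⟨A, hA⟩ : ∃ A : CMat q, A = (1 / 2 : ℂ) • (F Complex.I + (F Complex.I).conjTranspose) := ⟨_, rfl⟩
  have hAq : ∀ v, quad v A = ((quad v (F Complex.I)).re : ℂ) := fun v => by
    rw [hA, quad_smul, map_add, quad_conjTranspose, Complex.star_def, Complex.add_conj]
    push_cast; ring
  refine ⟨(A, matOfQuadForm b, ν), ⟨?_, ?_, hνm, fun z hz => ext_quad fun v => ?_⟩⟩
  · exact isHermitian_iff_quad.2 fun v => by rw [hAq]; exact Complex.ofReal_im _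
  · refine posSemidef_iff_quad.2 fun v => ?_
    rw [hbq.quad_matOfQuadForm]
    exact Complex.zero_le_real.2 measureReal_nonneg
  · have hz : 0 < z.im := hz
    have h1 := hrep v _ (cayleyInv_mem_ball hz)
    have h2 := integral_herglotzRieszKernel_eq (hμ v) hz
    have h3 : (h v 0).im = -(quad v (F Complex.I)).re := by simp [hh, cayley_zero]
    simp only
    rw [map_add, map_add, quad_smul, hAq, hbq.quad_matOfQuadForm, quad_matInt hνm v
      ((integrable_iff_quadMeasure hνm).2 fun v => integrable_herglotzKernel _ hz), hνq, add_assoc,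
      ← h2]
    rw [h3] at h1
    simp only [hh, cayley_cayleyInv hz] at h1
    push_cast at h1
    linear_combination Complex.I * h1 + ((quad v (F z)) - ((quad v (F Complex.I)).re : ℂ)) * Complex.I_sq

/-! ### Asymptotics in sectors -/

lemma mul_le_im_of_mem_sector {r δ : ℝ} (hδ : 0 < δ) (hδ' : δ ≤ Real.pi / 2) {z : ℂ}
    (hz : z ∈ sector r δ) : ‖z‖ * Real.sin δ ≤ z.im := by
  rw [← Complex.norm_mul_sin_arg z]
  refine mul_le_mul_of_nonneg_left ?_ (norm_nonneg z)
  rcases le_total z.arg (Real.pi / 2) with h | h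
  · exact Real.sin_le_sin_of_le_of_le_pi_div_two (by linarith) h hz.2.1
  · rw [← Real.sin_pi_sub z.arg]
    exact Real.sin_le_sin_of_le_of_le_pi_div_two (by linarith) (by linarith) (by linarith [hz.2.2])

/-- The bound by `r` comes from `|t-z| ≥ Im z ≥ |z| sin δ`. The bound by `|t|` comes from `|t| Im z
= |Im (conj z (t-z))| ≤ |z| |t-z|`. -/
lemma mul_max_le_norm_of_mem_sector {r δ : ℝ} (hr : 0 < r) (hδ : 0 < δ) (hδ' : δ ≤ Real.pi / 2)
    {z : ℂ} (hz : z ∈ sector r δ) (t : ℝ) : Real.sin δ * max r |t| ≤ ‖(t : ℂ) - z‖ := by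
  have hs : 0 < Real.sin δ := Real.sin_pos_of_pos_of_lt_pi hδ (by linarith [Real.pi_pos])
  have him := mul_le_im_of_mem_sector hδ hδ' hz
  have hn : 0 < ‖z‖ := hr.trans_le hz.1
  rw [mul_max_of_nonneg _ _ hs.le]
  refine max_le ?_ ?_
  · refine le_trans ?_ (im_pos_le_norm_ofReal_sub t z)
    exact le_trans (by rw [mul_comm]; exact mul_le_mul_of_nonneg_right hz.1 hs.le) him
  · have h1 : |t| * z.im ≤ ‖z‖ * ‖(t : ℂ) - z‖ := by
      have h2 := Complex.abs_im_le_norm ((starRingEnd ℂ) z * ((t : ℂ) - z))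
      rw [norm_mul, Complex.norm_conj] at h2
      refine le_trans (le_of_eq ?_) h2
      have h3 : ((starRingEnd ℂ) z * ((t : ℂ) - z)).im = -(t * z.im) := by
        simp
        ring
      rw [h3, abs_neg, abs_mul, abs_of_nonneg (a := z.im)]
      exact le_trans (by positivity) him
    have h4 : ‖z‖ * (Real.sin δ * |t|) ≤ ‖z‖ * ‖(t : ℂ) - z‖ := by
      refine le_trans ?_ h1
      nlinarith [abs_nonneg t]
    exact le_of_mul_le_mul_left h4 hn

lemma tendsto_lintegral_pow_div_max {μ : Measure ℝ} {K : ℕ} {c : ℝ} (hc : 0 < c)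
    (hi : Integrable (fun t : ℝ => t ^ (K - 1)) μ) :
    Tendsto (fun r : ℝ => ∫⁻ t, ENNReal.ofReal (|t| ^ K / (c * max r |t|)) ∂μ) atTop (𝓝 0) := by
  have h0 : ∫⁻ _ : ℝ, (0 : ℝ≥0∞) ∂μ = 0 := by simp
  rw [← h0]
  refine tendsto_lintegral_filter_of_dominated_convergence
    (fun t => ENNReal.ofReal (|t| ^ (K - 1) / c)) (.of_forall fun r => by fun_prop) ?_ ?_ ?_
  · filter_upwards [eventually_ge_atTop 1] with r hr
    refine .of_forall fun t => ENNReal.ofReal_le_ofReal ?_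
    have hm : 0 < max r |t| := lt_max_of_lt_left (by linarith)
    rw [div_le_div_iff₀ (by positivity) hc]
    have : |t| ^ K ≤ |t| ^ (K - 1) * max r |t| := by
      -- For `K = 0` the exponent `K - 1` truncates to `0`, and the estimate uses `r ≥ 1` instead of
      -- `|t|`.
      rcases K with _ | K
      · simpa using Or.inl hr
      · rw [pow_succ]
        exact mul_le_mul_of_nonneg_left (le_max_right _ _) (by positivity)
    calc |t| ^ K * c ≤ |t| ^ (K - 1) * max r |t| * c := by gcongr
      _ = _ := by ring
  · have h1 := (hi.norm.div_const c)
    simp only [norm_pow, Real.norm_eq_abs] at h1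
    have h2 := h1.2
    rw [hasFiniteIntegral_iff_ofReal (.of_forall fun t => by positivity)] at h2
    exact h2.ne
  · refine .of_forall fun t => ?_
    rw [← ENNReal.ofReal_zero]
    refine (ENNReal.continuous_ofReal.tendsto 0).comp ?_
    refine Tendsto.div_atTop tendsto_const_nhds ?_
    exact Tendsto.const_mul_atTop hc (tendsto_atTop_mono (fun r => le_max_left r |t|) tendsto_id)

lemma shifted_eq_matInt {s : ℤ → CMat q} {F : ℂ → CMat q}
    (hσ : spectralMeasure F ∈ hermMeasures q)
    (hrep : ∀ v z, 0 < z.im → quad v (F z) = quad v (-s (-1)) +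
      ∫ t : ℝ, 1 / ((t : ℂ) - z) ∂quadMeasure hσ v) {K : ℕ}
    (hm : ∀ j < K, (spectralMeasure F).Integrable (fun t : ℝ => (t : ℂ) ^ j) ∧
      moment (spectralMeasure F) j = s j) {z : ℂ} (hz : 0 < z.im) :
    shifted s (K - 1) F z =
      matInt (spectralMeasure F) fun t : ℝ => (t : ℂ) ^ K / ((t : ℂ) - z) := by
  have key : ∀ v, Integrable (fun t : ℝ => (t : ℂ) ^ K / ((t : ℂ) - z)) (quadMeasure hσ v) ∧
      quad v (shifted s (K - 1) F z) =
        ∫ t : ℝ, (t : ℂ) ^ K / ((t : ℂ) - z) ∂quadMeasure hσ v := by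
    intro v
    refine eq_integral_pow_div hz (a := fun K : ℕ => quad v (shifted s ((K : ℤ) - 1) F z))
      (s := fun K : ℕ => quad v (s K)) ?_ (quad_shifted_succ s F v hz) K fun j hj => ?_
    · simp only [Nat.cast_zero, zero_sub, shifted_neg_one, map_add, hrep v z hz, map_neg]
      ring
    · exact ⟨integrable_quadMeasure hσ v (hm j hj).1, by
        rw [← (hm j hj).2, moment, quad_matInt hσ v (hm j hj).1]⟩
  refine ext_quad fun v => ?_
  rw [(key v).2, quad_matInt hσ v ((integrable_iff_quadMeasure hσ).2 fun v => (key v).1)]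

theorem tendsto_shifted_sector {κ : ℕ∞} {s : ℤ → CMat q} {F : ℂ → CMat q}
    (hF : F ∈ nevanlinnaPrescribed κ s) {k : ℤ} (hk : -1 ≤ k) (hkκ : ((k.toNat : ℕ) : ℕ∞) ≤ κ)
    {δ : ℝ} (hδ : 0 < δ) (hδ' : δ ≤ Real.pi / 2) :
    Tendsto (fun r : ℝ => ⨆ z ∈ sector r δ, ‖shifted s k F z‖ₑ) atTop (𝓝 0) := by
  obtain ⟨⟨hF0, hmm⟩, hγ, hsol⟩ := hF
  obtain ⟨-, hσ, hrep⟩ := isCauchyTransform_of_mem_nevanlinnaZero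
    (exists_isNevanlinnaParam hF0.1) hF0
  rw [hγ] at hrep
  -- For `k = -1`, both `k.toNat` and `K - 1` are `0`; the zeroth moment is available for every `κ`,
  -- so no separate case is needed.
  obtain ⟨K, rfl⟩ : ∃ K : ℕ, k = (K : ℤ) - 1 := ⟨(k + 1).toNat, by omega⟩
  have hK : ((K : ℤ) - 1).toNat = K - 1 := by omega
  rw [hK] at hkκ
  have hs : 0 < Real.sin δ := Real.sin_pos_of_pos_of_lt_pi hδ (by linarith [Real.pi_pos])
  have hκ : ∀ j : ℕ, j ≤ K - 1 → (j : ℕ∞) ≤ κ := fun j hj =>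
    le_trans (by exact_mod_cast hj) hkκ
  have hlim := ENNReal.Tendsto.const_mul (a := ‖scalarPairing q‖ₑ) (tendsto_lintegral_pow_div_max
    (K := K) hs (integrable_ofReal_pow.1 (hmm.2 (K - 1) (hκ _ le_rfl)))) (Or.inr (by simp))
  rw [mul_zero] at hlim
  refine tendsto_of_tendsto_of_tendsto_of_le_of_le' tendsto_const_nhds hlim
    (.of_forall fun r => zero_le) ?_
  filter_upwards [eventually_gt_atTop 0] with r hr
  refine iSup₂_le fun z hz => ?_
  have him : 0 < z.im := lt_of_lt_of_le (mul_pos (hr.trans_le hz.1) hs)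
    (mul_le_im_of_mem_sector hδ hδ' hz)
  rw [shifted_eq_matInt hσ hrep (fun j hj => ⟨hmm.2 j (hκ j (by omega)),
    hsol.2 j (hκ j (by omega))⟩) him]
  refine VectorMeasure.enorm_integral_le_lintegral_enorm.trans ?_
  refine mul_le_mul' le_rfl (lintegral_mono fun t => ?_)
  rw [← ofReal_norm, norm_div, norm_pow, Complex.norm_real, Real.norm_eq_abs]
  refine ENNReal.ofReal_le_ofReal ?_
  have hm : 0 < max r |t| := lt_max_of_lt_left hr
  exact div_le_div_of_nonneg_left (by positivity) (by positivity)
    (mul_max_le_norm_of_mem_sector hr hδ hδ' hz t)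

/-! ### Sufficient conditions -/

lemma mem_nevanlinnaPrescribed {F : ℂ → CMat q} (hF : F ∈ nevanlinna q)
    (hC : IsCauchyTransform F) (hσ : spectralMeasure F ∈ hermMeasures q) {s : ℤ → CMat q}
    (hγ : gamma F = -s (-1)) {N : ℕ}
    (hm : ∀ v, ∀ j < N + 1, Integrable (fun t : ℝ => (t : ℂ) ^ j) (quadMeasure hσ v) ∧
      ∫ t : ℝ, (t : ℂ) ^ j ∂quadMeasure hσ v = quad v (s j)) :
    F ∈ nevanlinnaPrescribed (N : ℕ∞) s := by
  have hi : ∀ j : ℕ, (j : ℕ∞) ≤ (N : ℕ∞) →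
      (spectralMeasure F).Integrable fun t : ℝ => (t : ℂ) ^ j := fun j hj =>
    (integrable_iff_quadMeasure hσ).2 fun v => (hm v j (Nat.lt_succ_of_le (by exact_mod_cast hj))).1
  refine ⟨⟨hC.mem_nevanlinnaZero hF, hσ, hi⟩, hγ, ⟨hσ, hi⟩, fun j hj => ext_quad fun v => ?_⟩
  rw [moment, quad_matInt hσ v (hi j hj)]
  exact (hm v j (Nat.lt_succ_of_le (by exact_mod_cast hj))).2

/-- Decay descends to `F^{<0>}`, which bounds `y Im F(iy)` and makes `F` a Cauchy transform. Decay
of `F^{<-1>}` identifies `γ_F`, and the scalar argument supplies the moments. The limit is assumed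
only for each form, since the odd case produces it by dividing scalars by `iy`. -/
lemma moments_of_tendsto_shifted {n : ℕ} {s : ℤ → CMat q}
    (hs : ∀ j : ℤ, -1 ≤ j → j ≤ 2 * n → (s j).IsHermitian) {F : ℂ → CMat q}
    (hF : F ∈ nevanlinna q)
    (hlim : ∀ v, Tendsto (fun y : ℝ => quad v (shifted s (2 * n) F (Complex.I * (y : ℂ))))
      atTop (𝓝 0)) :
    IsCauchyTransform F ∧ gamma F = -s (-1) ∧ ∃ hσ : spectralMeasure F ∈ hermMeasures q,
      (∀ v z, 0 < z.im → quad v (F z) = quad v (-s (-1)) +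
        ∫ t : ℝ, 1 / ((t : ℂ) - z) ∂quadMeasure hσ v) ∧
      ∀ v, ∀ j < 2 * n + 1, Integrable (fun t : ℝ => (t : ℂ) ^ j) (quadMeasure hσ v) ∧
        ∫ t : ℝ, (t : ℂ) ^ j ∂quadMeasure hσ v = quad v (s j) := by
  set a : (Fin q → ℂ) → ℕ → ℝ → ℂ := fun v K y =>
    quad v (shifted s ((K : ℤ) - 1) F (Complex.I * (y : ℂ))) with ha
  have hrec : ∀ v K, ∀ y : ℝ, 0 < y → a v (K + 1) y = Complex.I * y * a v K y + quad v (s K) :=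
    fun v K y hy => quad_shifted_succ s F v (im_I_mul_pos hy) K
  have ha0 : ∀ v y, a v 0 y = quad v (F (Complex.I * y)) + quad v (s (-1)) := fun v y => by
    simp only [ha, Nat.cast_zero, zero_sub, shifted_neg_one, map_add]
  have hlim' : ∀ v, Tendsto (a v (2 * n + 1)) atTop (𝓝 0) := fun v => by
    simpa [ha] using hlim v
  have him : ∀ v, (quad v (s (-1))).im = 0 := fun v =>
    isHermitian_iff_quad.1 (hs (-1) le_rfl (by omega)) v
  have hC : IsCauchyTransform F := by
    refine isCauchyTransform_of_bounded (exists_isNevanlinnaParam hF) fun v =>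
      -- The real part of `v* F^{<0>}(iy) v` is `-y Im (v* F(iy) v) + v* s_0 v`, and it eventually
      -- exceeds `-1`.
      ⟨(quad v (s 0)).re + 1, ?_⟩
    have h1 := (Complex.continuous_re.tendsto 0).comp
      (tendsto_zero_of_le (hrec v) (hlim' v) 1 (by omega))
    filter_upwards [eventually_gt_atTop 0, h1.eventually (lt_mem_nhds (a := -1) (by simp))]
      with y hy h2
    have h3 := hrec v 0 y hy
    rw [ha0] at h3
    simp only [Function.comp, zero_add, Nat.cast_zero] at h2 h3
    rw [h3] at h2
    simp [him v] at h2
    linarith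
  obtain ⟨hγ, hσ, hrep⟩ := id hC
  have hγ' : gamma F = -s (-1) := by
    refine ext_quad fun v => ?_
    have h1 := tendsto_zero_of_le (hrec v) (hlim' v) 0 (by omega)
    have h2 : Tendsto (a v 0) atTop (𝓝 (quad v (gamma F) + 0 + quad v (s (-1)))) := by
      refine (((tendsto_integral_cauchyKernel (quadMeasure hσ v)).const_add _).add_const _).congr' ?_
      filter_upwards [eventually_gt_atTop 0] with y hy
      rw [ha0, hrep v _ (im_I_mul_pos hy)]
    have h3 := tendsto_nhds_unique h1 h2
    rw [map_neg]
    linear_combination -h3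
  rw [hγ'] at hrep
  refine ⟨hC, hγ', hσ, hrep, fun v => ?_⟩
  refine moments_of_tendsto (a := a v) (s := fun K : ℕ => quad v (s K)) (fun y hy => ?_) (hrec v)
    (fun j hj => isHermitian_iff_quad.1 (hs j (by omega) (by omega)) v) (hlim' v)
  rw [ha0, hrep v _ (im_I_mul_pos hy), map_neg]
  ring

theorem mem_nevanlinnaPrescribed_even {n : ℕ} {s : ℤ → CMat q}
    (hs : ∀ j : ℤ, -1 ≤ j → j ≤ 2 * n → (s j).IsHermitian) {F : ℂ → CMat q}
    (hF : F ∈ nevanlinna q)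
    (hlim : Tendsto (fun y : ℝ => shifted s (2 * n) F (Complex.I * (y : ℂ))) atTop (𝓝 0)) :
    F ∈ nevanlinnaPrescribed ((2 * n : ℕ) : ℕ∞) s := by
  obtain ⟨hC, hγ, hσ, -, hm⟩ := moments_of_tendsto_shifted hs hF fun v => by
    simpa using tendsto_quad hlim v
  exact mem_nevanlinnaPrescribed hF hC hσ hγ hm

lemma differentiableOn_shifted (s : ℤ → CMat q) {k : ℤ} {F : ℂ → CMat q}
    (hF : DifferentiableOn ℂ F upperHalf) : DifferentiableOn ℂ (shifted s k F) upperHalf := by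
  have hz : ∀ m : ℤ, DifferentiableOn ℂ (fun z : ℂ => z ^ m) upperHalf := fun m z hz =>
    (differentiableAt_zpow.2 (Or.inl (upperHalf_ne_zero hz))).differentiableWithinAt
  exact ((hz _).smul hF).add (DifferentiableOn.fun_sum fun j _ => (hz _).smul_const _)

theorem shifted_odd {n : ℕ} {s : ℤ → CMat q}
    (hs : ∀ j : ℤ, -1 ≤ j → j ≤ 2 * n + 1 → (s j).IsHermitian) {F : ℂ → CMat q}
    (hF : F ∈ nevanlinna q)
    (hlim : Tendsto (fun y : ℝ => shifted s (2 * n + 1) F (Complex.I * (y : ℂ))) atTop (𝓝 0)) :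
    shifted s (2 * n + 1) F ∈ nevanlinna q ∧
      (shifted s (2 * n + 1) F ∈ nevanlinnaNegOne q →
        F ∈ nevanlinnaPrescribed ((2 * n + 1 : ℕ) : ℕ∞) s) := by
  have hsucc : ∀ v z, 0 < z.im → quad v (shifted s (2 * n + 1) F z) =
      z * quad v (shifted s (2 * n) F z) + quad v (s ((2 * n + 1 : ℕ) : ℤ)) := fun v z hz => by
    have := quad_shifted_succ s F v hz (2 * n + 1)
    push_cast at this ⊢
    simpa [add_sub_assoc] using this
  have hlim' : ∀ v, Tendsto (fun y : ℝ => quad v (shifted s (2 * n + 1) F (Complex.I * (y : ℂ))))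
      atTop (𝓝 0) := fun v => by simpa using tendsto_quad hlim v
  obtain ⟨hC, hγ, hσ, hrep, hm⟩ := moments_of_tendsto_shifted
    (fun j h1 h2 => hs j h1 (by omega)) hF fun v =>
      tendsto_zero_of_mul_add (fun y hy => hsucc v _ (im_I_mul_pos hy)) (hlim' v)
  have key : ∀ v z, 0 < z.im →
      Integrable (fun t : ℝ => (t : ℂ) ^ (2 * n + 1) / ((t : ℂ) - z)) (quadMeasure hσ v) ∧
      quad v (shifted s (2 * n) F z) =
        ∫ t : ℝ, (t : ℂ) ^ (2 * n + 1) / ((t : ℂ) - z) ∂quadMeasure hσ v := by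
    intro v z hz
    have := eq_integral_pow_div hz (a := fun K : ℕ => quad v (shifted s ((K : ℤ) - 1) F z))
      (s := fun K : ℕ => quad v (s K)) (σ := quadMeasure hσ v) (by
        simp only [Nat.cast_zero, zero_sub, shifted_neg_one, map_add, hrep v z hz, map_neg]
        ring) (quad_shifted_succ s F v hz) (2 * n + 1) (hm v)
    simpa using this
  have him : ∀ v, (quad v (s ((2 * n + 1 : ℕ) : ℤ))).im = 0 := fun v =>
    isHermitian_iff_quad.1 (hs _ (by omega) (by push_cast; omega)) v
  refine ⟨⟨differentiableOn_shifted s hF.1, fun z hz => ?_⟩, fun hN => ?_⟩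
  · rw [posSemidef_iff_quad]
    intro v
    rw [quad_imPart, hsucc v z hz, Complex.add_im, him, add_zero, (key v z hz).2]
    exact_mod_cast im_mul_integral_odd_pow_nonneg hz (key v z hz).1
  · have hint : ∀ v, Integrable (fun t : ℝ => t ^ (2 * n + 1)) (quadMeasure hσ v) := by
      intro v
      have hre : ∀ y : ℝ, 0 < y →
          Integrable (fun t : ℝ => t ^ (2 * n + 2) / (t ^ 2 + y ^ 2)) (quadMeasure hσ v) ∧
          ∫ t : ℝ, t ^ (2 * n + 2) / (t ^ 2 + y ^ 2) ∂quadMeasure hσ v =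
            (quad v (shifted s (2 * n) F (Complex.I * y))).re := by
        intro y hy
        obtain ⟨h1, h2⟩ := key v _ (im_I_mul_pos hy)
        simp only [← re_pow_div_ofReal_sub hy]
        exact ⟨h1.re, by rw [h2]; exact integral_re h1⟩
      -- Since `s_{2n+1}` is Hermitian, `Re (v* F^{<2n>}(iy) v) = Im (v* F^{<2n+1>}(iy) v) / y`,
      -- which the hypothesis on `F^{<2n+1>}` makes integrable in `y`.
      refine integrable_odd_pow (hN.2.const_mul ‖quad v‖) (fun y hy => (hre y hy).1) fun y hy => ?_
      have hy0 : 0 < y := by linarith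
      have h3 : (quad v (shifted s (2 * n + 1) F (Complex.I * y))).im =
          y * (quad v (shifted s (2 * n) F (Complex.I * y))).re := by
        rw [hsucc v _ (im_I_mul_pos hy0), Complex.add_im, him]
        simp
      have h4 : (quad v (shifted s (2 * n + 1) F (Complex.I * y))).im ≤
          ‖quad v‖ * ‖imPart (shifted s (2 * n + 1) F (Complex.I * y))‖ := by
        refine le_trans ?_ ((quad v).le_opNorm _)
        rw [quad_imPart, Complex.norm_real]
        exact le_abs_self _
      rw [(hre y hy0).2]
      rw [h3] at h4
      calc (quad v (shifted s (2 * n) F (Complex.I * y))).re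
          = 1 / y * (y * (quad v (shifted s (2 * n) F (Complex.I * y))).re) := by field_simp
        _ ≤ 1 / y * (‖quad v‖ * ‖imPart (shifted s (2 * n + 1) F (Complex.I * y))‖) := by gcongr
        _ = _ := by ring
    -- Moments up to `2n` come from the even case; once the top one exists, decay of `F^{<2n+1>}`
    -- determines its value.
    refine mem_nevanlinnaPrescribed hF hC hσ hγ fun v j hj => ?_
    rcases Nat.lt_succ_iff_lt_or_eq.1 hj with hj | rfl
    · exact hm v j hj
    · have hi := integrable_ofReal_pow.2 (hint v)
      exact ⟨hi, moment_eq_of_tendsto (fun y hy => (key v _ (im_I_mul_pos hy)).2)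
        (fun y hy => hsucc v _ (im_I_mul_pos hy)) (hlim' v) hi⟩

end HamburgerNevanlinna

end

theorem mainTheorem12 (q : ℕ) (hq : 0 < q) :
    -- asymptotics in sectors of the functions with prescribed data
    (∀ (κ : ℕ∞) (s : ℤ → CMat q) (F : ℂ → CMat q), F ∈ nevanlinnaPrescribed κ s →
      ∀ k : ℤ, -1 ≤ k → ((k.toNat : ℕ) : ℕ∞) ≤ κ →
      ∀ δ : ℝ, 0 < δ → δ ≤ Real.pi / 2 →
        Tendsto (fun r : ℝ => ⨆ z ∈ sector r δ, ‖shifted s k F z‖ₑ) atTop (𝓝 0)) ∧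
    -- sufficient condition, even case
    (∀ (n : ℕ) (s : ℤ → CMat q), (∀ j : ℤ, -1 ≤ j → j ≤ 2 * n → (s j).IsHermitian) →
      ∀ F ∈ nevanlinna q,
        Tendsto (fun y : ℝ => shifted s (2 * n) F (Complex.I * (y : ℂ))) atTop (𝓝 0) →
        F ∈ nevanlinnaPrescribed ((2 * n : ℕ) : ℕ∞) s) ∧
    -- sufficient condition, odd case
    (∀ (n : ℕ) (s : ℤ → CMat q), (∀ j : ℤ, -1 ≤ j → j ≤ 2 * n + 1 → (s j).IsHermitian) →
      ∀ F ∈ nevanlinna q,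
        Tendsto (fun y : ℝ => shifted s (2 * n + 1) F (Complex.I * (y : ℂ))) atTop (𝓝 0) →
        shifted s (2 * n + 1) F ∈ nevanlinna q ∧
        (shifted s (2 * n + 1) F ∈ nevanlinnaNegOne q →
          F ∈ nevanlinnaPrescribed ((2 * n + 1 : ℕ) : ℕ∞) s)) :=
  ⟨fun _ _ _ hF _ hk hkκ _ hδ hδ' => tendsto_shifted_sector hF hk hkκ hδ hδ',
    fun _ _ hs _ hF hlim => mem_nevanlinnaPrescribed_even hs hF hlim,
    fun _ _ hs _ hF hlim => shifted_odd hs hF hlim⟩
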